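/- Let $m,n\ge 0$ be integers and let $\mathbb K$ be $\mathbb R$ or $\mathbb C$ (or any field with a fixed embedding into $\mathbb C$). Indices $1\le i\le m$ have parity $|i|=0$ and indices $m<i\le m+2n$ have parity $|i|=1$. Put $$\beta=\begin{pmatrix} I_m&0&0\\0&0&-I_n\\0&I_n&0\end{pmatrix},\qquad (\beta^{ij})=\beta^{-1},$$ and let $\Omega$ be the even skew-supersymmetric form on $\mathbb K^{2m|4n}$ with basis indices $\tilde\imath,\underline{i}$ ($1\le i\le m+2n$, $|\tilde\imath|=|\underline i|=|i|$) given by $\Omega_{\tilde\imath\,\underline j}=-\beta_{ij}$, $\Omega_{\underline i\,\tilde\jmath}=\beta_{ij}$, $\Omega_{\tilde\imath\,\tilde\jmath}=\Omega_{\underline i\,\underline j}=0$. Let $$\mathfrak g=\mathfrak{spo}(2m|2n,2n)=\{X\in\mathfrak{gl}_{\mathbb K}(2m|4n): X^{ST}\Omega+\Omega X=0\},$$ where $(X^{ST})_{ba}=(-1)^{|b|(|a|+|b|)}X_{ab}$. It is spanned by the elements $U_{ab}=\sum_k\big(\Omega_{bk}E_{ak}+(-1)^{|a||b|}\Omega_{ak}E_{bk}\big)$.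 For $\mathbb F\in\{\mathbb R,\mathbb C\}$ let $\ell_1,\dots,\ell_{m+2n}$ be the coordinates of $\mathbb F^{m|2n}$ and consider the superfunctions $C^\infty(\mathbb F^m)\otimes\Lambda(\mathbb C^{2n})$ (complex valued; holomorphic if $\mathbb F=\mathbb C$). Put $\partial_i=\sum_j\beta_{ij}\partial_{\ell_j}$ (left derivatives) and $R^2=\sum_{i,j}\beta^{ij}\ell_i\ell_j$. Let $\tilde\pi$ be the action on superfunctions with $$\tilde\pi(U_{\underline i\,\underline j})=2\imath\,\ell_i\ell_j,\qquad \tilde\pi(U_{\tilde\imath\,\underline j})=-\tfrac12\beta_{ij}-(-1)^{|i||j|}\ell_j\partial_i,\qquad \tilde\pi(U_{\tilde\imath\,\tilde\jmath})=-\tfrac{\imath}{2}\partial_i\partial_j ,$$ extended $\mathbb C$-linearly to $\mathfrak g_{\mathbb C}$. Let $e^-=-\tfrac12\sum\beta^{ij}U_{\underline i\,\underline j}$, $e^+=\tfrac12\sum\beta^{ij}U_{\tilde\imath\,\tilde\jmath}$, let $c=\exp(\tfrac{\imath}{2}\operatorname{ad}e^-)\exp(\imath\operatorname{ad}e^+)$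 be the Cayley transform of $\mathfrak g_{\mathbb C}$, and let $\tilde\rho=\tilde\pi\circ c$. Define $$\widetilde W=U(\mathfrak g)\exp(-R^2)+U(\mathfrak g)\,\ell_1\exp(-R^2)\quad\text{(on }\mathbb R^{m|2n}\text{, action }\tilde\pi),\qquad \widetilde F=U(\mathfrak g)\,1+U(\mathfrak g)\,\ell_1\quad\text{(on }\mathbb C^{m|2n}\text{, action }\tilde\rho),$$ where these are complex subspaces and, if $m=n=0$, the second summands are $0$. Let $\int_{\mathbb R^{m|2n}}dx=\int_{\mathbb R^m}dx_{\bar 0}\,\pi^{-n}\partial_{x_{m+2n}}\cdots\partial_{x_{m+1}}$, let $\omega=\int_{\mathbb R^{m|2n}}\exp(-2R^2)\,dx$ and $z\bullet x=\sum_{i,j}\beta^{ij}z_ix_j$ (the variables $z$ and $x$ supercommute), and define the Segal–Bargmann transform $$\mathrm{SB}(f)(z)=\frac1\omega\exp(-\tfrac12R_z^2)\int_{\mathbb R^{m|2n}}\exp(2(z\bullet x))\exp(-R_x^2)f(x)\,dx .$$ **Theorem (intertwining property).** The transform is well defined on $\widetilde W$: $\omega\neq0$, and the integrand is integrable over $x_{\bar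 0}\in\mathbb R^m$ for every $f\in\widetilde W$ and $z_{\bar 0}\in\mathbb C^m$. It is a linear map $\mathrm{SB}:\widetilde W\to\widetilde F$, and it intertwines the action $\tilde\pi$ on $\widetilde W$ with the action $\tilde\rho$ on $\widetilde F$: $$\mathrm{SB}\circ\tilde\pi(X)=\tilde\rho(X)\circ\mathrm{SB}\qquad\text{for all }X\in\mathfrak g .$$ -/

import Mathlib

open scoped ContDiff
open MeasureTheory

namespace SuperSB

/-! ### Indices, parities, and the orthosymplectic matrices -/

/-- Indices of the coordinates of `𝕂^{m|2n}`: `m` even ones followed by `2n` odd ones. -/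
abbrev Idx (m n : ℕ) : Type := Fin m ⊕ Fin (2 * n)

/-- The parity of an index of `𝕂^{m|2n}`. -/
def par {m n : ℕ} : Idx m n → ℕ := Sum.elim (fun _ => 0) (fun _ => 1)

/-- Zero-based position of an index in the ordered list of the `m + 2n` coordinates. -/
def pos {m n : ℕ} : Idx m n → ℕ := Sum.elim (fun i => i.val) (fun j => m + j.val)

/-- The matrix `β = diag(I_m, [[0, -I_n], [I_n, 0]])` of the supersymmetric form. -/
def beta (R : Type*) [CommRing R] (m n : ℕ) : Matrix (Idx m n) (Idx m n) R :=
  Matrix.fromBlocks 1 0 0 (Matrix.of fun j k : Fin (2 * n) =>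
    if k.val = j.val + n then -1 else if j.val = k.val + n then 1 else 0)

/-- Indices of `𝕂^{2m|4n}`. The left copy consists of the indices `ĩ` (positions `1, …, m` among the
even ones and `1, …, 2n` among the odd ones), the right copy of the indices `i̲` (positions
`m + 1, …, 2m` among the even ones and `2n + 1, …, 4n` among the odd ones). -/
abbrev DIdx (m n : ℕ) : Type := Idx m n ⊕ Idx m n

/-- The parity of an index of `𝕂^{2m|4n}`. -/
def dpar {m n : ℕ} : DIdx m n → ℕ := Sum.elim par par

/-- The matrix `Ω` of the skew-supersymmetric form on `𝕂^{2m|4n}`: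
`Ω_{ĩ j̲} = -β_{ij}`, `Ω_{i̲ j̃} = β_{ij}`, other entries zero. In the order
(even | odd) this is `diag([[0, -I], [I, 0]], antidiag(I, -I, -I, I))`. -/
def Omega (R : Type*) [CommRing R] (m n : ℕ) : Matrix (DIdx m n) (DIdx m n) R :=
  Matrix.fromBlocks 0 (-beta R m n) (beta R m n) 0

/-! ### The Lie superalgebra `spo(2m|4n, Ω) = spo(2m|2n,2n)` and its Cayley transform -/

section LieSuperalgebra

variable {R : Type*} [CommRing R] {m n : ℕ}

/-- The supertranspose: `(X^{ST})_{ji} = (-1)^{|j|(|i|+|j|)} X_{ij}`. -/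
def superTranspose (X : Matrix (DIdx m n) (DIdx m n) R) : Matrix (DIdx m n) (DIdx m n) R :=
  Matrix.of fun j i => (-1) ^ (dpar j * (dpar i + dpar j)) * X i j

/-- The supercommutator `[X, Y] = XY - (-1)^{|X||Y|} YX` of `gl(2m|4n)`, extended bilinearly
(the matrix unit `E_{ij}` has parity `|i| + |j|`). -/
def superBracket (X Y : Matrix (DIdx m n) (DIdx m n) R) : Matrix (DIdx m n) (DIdx m n) R :=
  Matrix.of fun p q => ∑ r, (X p r * Y r q
    - (-1) ^ ((dpar p + dpar r) * (dpar r + dpar q)) * (Y p r * X r q))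

/-- The underlying space of the Lie superalgebra `spo(2m|4n, Ω)`. -/
def spo (R : Type*) [CommRing R] (m n : ℕ) : Submodule R (Matrix (DIdx m n) (DIdx m n) R) where
  carrier := {X | superTranspose X * Omega R m n + Omega R m n * X = 0}
  add_mem' {X Y} hX hY := by
    have h : superTranspose (X + Y) = superTranspose X + superTranspose Y := by
      ext; simp [superTranspose, mul_add]
    change superTranspose _ * _ + _ = 0
    change superTranspose _ * _ + _ = 0 at hX
    change superTranspose _ * _ + _ = 0 at hY
    rw [h, add_mul, mul_add, add_add_add_comm, hX, hY, add_zero]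
  zero_mem' := by
    have h : superTranspose (0 : Matrix (DIdx m n) (DIdx m n) R) = 0 := by
      ext; simp [superTranspose]
    simp [h]
  smul_mem' c X hX := by
    have h : superTranspose (c • X) = c • superTranspose X := by
      ext; simp [superTranspose, mul_left_comm]
    change superTranspose _ * _ + _ = 0
    change superTranspose _ * _ + _ = 0 at hX
    rw [h, Matrix.smul_mul, Matrix.mul_smul, ← smul_add, hX, smul_zero]

/-- The elements `U_{ij} = ∑_k (Ω_{jk} E_{ik} + (-1)^{|i||j|} Ω_{ik} E_{jk})`, which span
`spo(2m|4n, Ω)`. -/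
def U (i j : DIdx m n) : Matrix (DIdx m n) (DIdx m n) R :=
  ∑ k, (Matrix.single i k (Omega R m n j k)
    + Matrix.single j k ((-1) ^ (dpar i * dpar j) * Omega R m n i k))

/-- The adjoint action `X ↦ [E, X]`. -/
def ad (E : Matrix (DIdx m n) (DIdx m n) R) : Module.End R (Matrix (DIdx m n) (DIdx m n) R) where
  toFun X := superBracket E X
  map_add' X Y := by
    ext p q
    simp only [superBracket, Matrix.of_apply, Matrix.add_apply, ← Finset.sum_add_distrib]
    exact Finset.sum_congr rfl fun r _ => by ring
  map_smul' c X := by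
    ext p q
    simp only [superBracket, Matrix.of_apply, Matrix.smul_apply, smul_eq_mul, Finset.mul_sum,
      RingHom.id_apply]
    exact Finset.sum_congr rfl fun r _ => by ring

end LieSuperalgebra

/-- `e⁻ = -½ ∑ β^{ij} U_{i̲ j̲}`: the unit of the Jordan superalgebra `JOSP(m|2n)` in the degree
`-1` part of the `3`-grading. -/
noncomputable def eMinus (m n : ℕ) : Matrix (DIdx m n) (DIdx m n) ℂ :=
  -(1 / 2 : ℂ) • ∑ i : Idx m n, ∑ j : Idx m n, (beta ℂ m n)⁻¹ i j • U (Sum.inr i) (Sum.inr j)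

/-- `e⁺ = ½ ∑ β^{ij} U_{ĩ j̃}`: the unit of `JOSP(m|2n)` in the degree `+1` part. -/
noncomputable def ePlus (m n : ℕ) : Matrix (DIdx m n) (DIdx m n) ℂ :=
  (1 / 2 : ℂ) • ∑ i : Idx m n, ∑ j : Idx m n, (beta ℂ m n)⁻¹ i j • U (Sum.inl i) (Sum.inl j)

/-- The Cayley transform `c = exp((i/2) ad e⁻) exp(i ad e⁺)`; both exponents are nilpotent. -/
noncomputable def cayley (m n : ℕ) : Module.End ℂ (Matrix (DIdx m n) (DIdx m n) ℂ) :=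
  IsNilpotent.exp ((Complex.I / 2) • ad (eMinus m n)) *
    IsNilpotent.exp (Complex.I • ad (ePlus m n))

/-! ### Grassmann algebras -/

/-- The complex Grassmann algebra `Λ(V)` of a space `V` of odd variables. -/
def Grassmann (V : Type) [AddCommGroup V] [Module ℂ V] : Type := ExteriorAlgebra ℂ V

namespace Grassmann

variable {V W : Type} [AddCommGroup V] [Module ℂ V] [AddCommGroup W] [Module ℂ W]

noncomputable instance : Ring (Grassmann V) := inferInstanceAs (Ring (ExteriorAlgebra ℂ V))

noncomputable instance : Algebra ℂ (Grassmann V) :=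
  inferInstanceAs (Algebra ℂ (ExteriorAlgebra ℂ V))

/-- The odd generators. -/
noncomputable def gen : V →ₗ[ℂ] Grassmann V := ExteriorAlgebra.ι ℂ

/-- The odd left derivative: contraction with a linear form `d` on `V`, determined by
`∂ 1 = 0` and `∂ (v a) = d(v) a - v ∂ a`. -/
noncomputable def contract (d : Module.Dual ℂ V) : Module.End ℂ (Grassmann V) :=
  CliffordAlgebra.contractLeft (Q := (0 : QuadraticForm ℂ V)) d

/-- The homomorphism `Λ(V) → Λ(W)` induced by a linear map of odd variables. -/
noncomputable def map (f : V →ₗ[ℂ] W) : Grassmann V →ₐ[ℂ] Grassmann W := ExteriorAlgebra.map f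

/-- The body homomorphism, onto the component of degree zero. -/
noncomputable def body : Grassmann V →ₐ[ℂ] ℂ :=
  (ExteriorAlgebra.algebraMapInv : ExteriorAlgebra ℂ V →ₐ[ℂ] ℂ)

variable [FiniteDimensional ℂ V]

instance : FiniteDimensional ℂ (Grassmann V) :=
  Module.Finite.of_basis (M := ExteriorAlgebra ℂ V) (Module.finBasis ℂ V).ExteriorAlgebra

/-- A norm on the finite-dimensional space `Λ(V)` (any two norms are equivalent); it serves only
to differentiate and to integrate functions with values in `Λ(V)`. -/
noncomputable instance : NormedAddCommGroup (Grassmann V) :=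
  NormedAddCommGroup.induced (Grassmann V) (Fin (Module.finrank ℂ (Grassmann V)) → ℂ)
    (Module.finBasis ℂ (Grassmann V)).equivFun.toLinearMap
    (Module.finBasis ℂ (Grassmann V)).equivFun.injective

noncomputable instance : NormedSpace ℂ (Grassmann V) :=
  NormedSpace.induced ℂ (Grassmann V) (Fin (Module.finrank ℂ (Grassmann V)) → ℂ)
    (Module.finBasis ℂ (Grassmann V)).equivFun.toLinearMap

/-- The exponential of an element of `Λ(V)`: the exponential of the body times the (terminating)
exponential series of the nilpotent part. -/
noncomputable def gexp (a : Grassmann V) : Grassmann V :=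
  Complex.exp (body a) • ∑ k ∈ Finset.range (Module.finrank ℂ V + 1),
    (k.factorial : ℂ)⁻¹ • (a - algebraMap ℂ (Grassmann V) (body a)) ^ k

/-- The Berezin integral `π^{-n} ∂_{2n} ∂_{2n-1} ⋯ ∂_1` with respect to `2n` odd variables, where
`∂_j` is the odd left derivative along the `j`-th of `2n` linear forms on `V`. -/
noncomputable def berezin {n : ℕ} (d : Fin (2 * n) → Module.Dual ℂ V) :
    Module.End ℂ (Grassmann V) :=
  ((Real.pi : ℂ) ^ n)⁻¹ • ((List.finRange (2 * n)).reverse.map fun j => contract (d j)).prod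

end Grassmann

/-- The span of `2n` odd variables. -/
abbrev OddSpace (n : ℕ) : Type := Fin (2 * n) → ℂ

/-- The `j`-th odd variable. -/
def oddVec {n : ℕ} (j : Fin (2 * n)) : OddSpace n := Pi.single j 1

/-- The `j`-th coordinate form. -/
def oddForm {n : ℕ} (j : Fin (2 * n)) : Module.Dual ℂ (OddSpace n) := LinearMap.proj j

/-- The Grassmann algebra in `2n` odd variables. -/
abbrev Lam (n : ℕ) : Type := Grassmann (OddSpace n)

/-- The Grassmann algebra in the `2n` odd variables `z` (first factor) and the `2n` odd
variables `x` (second factor), which all anticommute. -/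
abbrev Lam2 (n : ℕ) : Type := Grassmann (OddSpace n × OddSpace n)

/-! ### Superfunctions and differential operators

For `𝕂 = ℝ` or `𝕂 = ℂ`, a superfunction on `𝕂^{m|2n}` is a function on `𝕂^m` with values in the
Grassmann algebra. -/

section Superfunctions

variable (𝕂 : Type) [RCLike 𝕂] [NormedAlgebra 𝕂 ℂ] (m n : ℕ)
  [NormedSpace 𝕂 (Lam n)] [IsScalarTower 𝕂 ℂ (Lam n)]

/-- The space `C^∞(𝕂^m) ⊗ Λ(2n)` of smooth superfunctions on `𝕂^{m|2n}`
(entire superfunctions if `𝕂 = ℂ`). -/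
def Smooth : Submodule ℂ ((Fin m → 𝕂) → Lam n) where
  carrier := {f | ContDiff 𝕂 ∞ f}
  add_mem' {f g} hf hg := by
    change ContDiff 𝕂 ∞ f at hf
    change ContDiff 𝕂 ∞ g at hg
    exact hf.add hg
  zero_mem' := by
    change ContDiff 𝕂 ∞ fun _ : Fin m → 𝕂 => (0 : Lam n)
    exact contDiff_const
  smul_mem' c f hf := by
    change ContDiff 𝕂 ∞ f at hf
    exact hf.const_smul c

variable {𝕂 m n}

/-- The coordinate superfunctions `ℓ_i`. -/
noncomputable def coord (i : Idx m n) (x : Fin m → 𝕂) : Lam n :=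
  Sum.elim (fun i => algebraMap 𝕂 ℂ (x i) • (1 : Lam n))
    (fun j => Grassmann.gen (oddVec j)) i

/-- The superfunction `R² = ∑ β^{ij} ℓ_i ℓ_j`. -/
noncomputable def Rsq (x : Fin m → 𝕂) : Lam n :=
  ∑ i : Idx m n, ∑ j : Idx m n, (beta ℂ m n)⁻¹ i j • (coord i x * coord j x)

theorem contDiff_linear (L : Module.End ℂ (Lam n)) {f : (Fin m → 𝕂) → Lam n}
    (hf : ContDiff 𝕂 ∞ f) : ContDiff 𝕂 ∞ fun x => L (f x) :=
  ((LinearMap.toContinuousLinearMap L).restrictScalars 𝕂).contDiff.comp hf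

theorem contDiff_coord_mul (i : Idx m n) {f : (Fin m → 𝕂) → Lam n} (hf : ContDiff 𝕂 ∞ f) :
    ContDiff 𝕂 ∞ fun x => coord i x * f x := by
  rcases i with i | j
  · have h : ContDiff 𝕂 ∞ fun x : Fin m → 𝕂 => algebraMap 𝕂 ℂ (x i) :=
      (algebraMapCLM 𝕂 ℂ).contDiff.comp (contDiff_apply 𝕂 𝕂 i)
    have h2 : ContDiff 𝕂 ∞ fun x : Fin m → 𝕂 => algebraMap 𝕂 ℂ (x i) • f x := h.smul hf
    simpa only [coord, Sum.elim_inl, smul_mul_assoc, one_mul] using h2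
  · exact contDiff_linear (LinearMap.mulLeft ℂ (Grassmann.gen (oddVec j))) hf

theorem contDiff_mul {f g : (Fin m → 𝕂) → Lam n} (hf : ContDiff 𝕂 ∞ f) (hg : ContDiff 𝕂 ∞ g) :
    ContDiff 𝕂 ∞ fun x => f x * g x := by
  have h : ContDiff ℂ ∞ fun p : Lam n × Lam n => p.1 * p.2 :=
    (LinearMap.toContinuousLinearMap ((LinearMap.toContinuousLinearMap
      (E := Lam n) (F' := Lam n)).toLinearMap ∘ₗ
        LinearMap.mul ℂ (Lam n))).isBoundedBilinearMap.contDiff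
  exact (h.restrict_scalars 𝕂).comp (hf.prodMk hg)

theorem contDiff_gexp {f : (Fin m → 𝕂) → Lam n} (hf : ContDiff 𝕂 ∞ f) :
    ContDiff 𝕂 ∞ fun x => Grassmann.gexp (f x) := by
  have hb : ContDiff 𝕂 ∞ fun x => Grassmann.body (f x) :=
    ((LinearMap.toContinuousLinearMap
      (Grassmann.body (V := OddSpace n)).toLinearMap).restrictScalars 𝕂).contDiff.comp hf
  have hs : ContDiff 𝕂 ∞ fun x => f x - algebraMap ℂ (Lam n) (Grassmann.body (f x)) :=
    hf.sub (((LinearMap.toContinuousLinearMap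
      (Algebra.linearMap ℂ (Lam n))).restrictScalars 𝕂).contDiff.comp hb)
  have hp : ∀ k : ℕ, ContDiff 𝕂 ∞ fun x =>
      (f x - algebraMap ℂ (Lam n) (Grassmann.body (f x))) ^ k := by
    intro k
    induction k with
    | zero => simpa only [pow_zero] using contDiff_const
    | succ k ih => simpa only [pow_succ] using contDiff_mul ih hs
  exact hb.cexp.smul (ContDiff.sum fun k _ => (hp k).const_smul _)

/-- Multiplication by the coordinate `ℓ_i`. -/
noncomputable def mulOp (i : Idx m n) : Module.End ℂ (Smooth 𝕂 m n) where
  toFun f := ⟨fun x => coord i x * f.1 x, contDiff_coord_mul i f.2⟩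
  map_add' f g := by ext x; simp [mul_add]
  map_smul' c f := by ext x; simp

theorem smooth_differentiableAt (f : Smooth 𝕂 m n) (x : Fin m → 𝕂) :
    DifferentiableAt 𝕂 f.1 x := by
  have h : ContDiff 𝕂 ∞ f.1 := f.2
  exact h.differentiable (by simp) x

/-- The derivative `∂/∂x_i` with respect to an even coordinate. -/
noncomputable def evenDeriv (i : Fin m) : Module.End ℂ (Smooth 𝕂 m n) where
  toFun f := ⟨fun x => fderiv 𝕂 f.1 x (Pi.single i 1), by
    have h : ContDiff 𝕂 ∞ f.1 := f.2
    exact (h.fderiv_right (m := ∞) le_rfl).clm_apply contDiff_const⟩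
  map_add' f g := by
    ext1
    funext x
    change fderiv 𝕂 (f.1 + g.1) x _ = fderiv 𝕂 f.1 x _ + fderiv 𝕂 g.1 x _
    rw [fderiv_add (smooth_differentiableAt f x) (smooth_differentiableAt g x)]
    rfl
  map_smul' c f := by
    ext1
    funext x
    change fderiv 𝕂 (c • f.1) x _ = c • fderiv 𝕂 f.1 x _
    rw [fderiv_const_smul (smooth_differentiableAt f x) c]
    rfl

/-- The left derivative `∂/∂θ_j` with respect to an odd coordinate. -/
noncomputable def oddDeriv (j : Fin (2 * n)) : Module.End ℂ (Smooth 𝕂 m n) where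
  toFun f := ⟨fun x => Grassmann.contract (oddForm j) (f.1 x), contDiff_linear _ f.2⟩
  map_add' f g := by ext x; simp
  map_smul' c f := by ext x; simp

/-- `∂_i = ∑_j β_{ij} ∂/∂ℓ_j`. -/
noncomputable def partialLow (i : Idx m n) : Module.End ℂ (Smooth 𝕂 m n) :=
  ∑ j, beta ℂ m n i j • Sum.elim evenDeriv oddDeriv j

/-- The operators by which the elements `U_{ab}` of `spo(2m|4n, Ω)` act:
`U_{i̲ j̲} ↦ 2i ℓ_i ℓ_j`, `U_{ĩ j̲} ↦ -½ β_{ij} - (-1)^{|i||j|} ℓ_j ∂_i`,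
`U_{ĩ j̃} ↦ -(i/2) ∂_i ∂_j`, and `U_{i̲ j̃} = (-1)^{|i||j|} U_{j̃ i̲}`. -/
noncomputable def genOp : DIdx m n → DIdx m n → Module.End ℂ (Smooth 𝕂 m n)
  | Sum.inr i, Sum.inr j => (2 * Complex.I) • (mulOp i * mulOp j)
  | Sum.inl i, Sum.inr j => (-(1 / 2) * beta ℂ m n i j) • 1
      - (-1 : ℂ) ^ (par i * par j) • (mulOp j * partialLow i)
  | Sum.inr i, Sum.inl j => (-1 : ℂ) ^ (par i * par j) • ((-(1 / 2) * beta ℂ m n j i) • 1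
      - (-1 : ℂ) ^ (par i * par j) • (mulOp i * partialLow j))
  | Sum.inl i, Sum.inl j => (-(Complex.I / 2)) • (partialLow i * partialLow j)

/-- The action `π̃` of `spo_ℂ(2m|4n, Ω)` on smooth superfunctions on `𝕂^{m|2n}`. An element `X` of
`spo_ℂ(2m|4n, Ω)` is `½ ∑ c_{ab} U_{ab}` with `c = X Ω⁻¹`, and it acts by `½ ∑ c_{ab} genOp a b`. -/
noncomputable def metaplectic : Matrix (DIdx m n) (DIdx m n) ℂ →ₗ[ℂ]
    Module.End ℂ (Smooth 𝕂 m n) where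
  toFun X := (1 / 2 : ℂ) • ∑ a, ∑ b, (X * (Omega ℂ m n)⁻¹) a b • genOp a b
  map_add' X Y := by
    simp only [add_mul, Matrix.add_apply, add_smul, Finset.sum_add_distrib, smul_add]
  map_smul' c X := by
    simp only [Matrix.smul_mul, Matrix.smul_apply, smul_eq_mul, mul_smul, Finset.smul_sum,
      RingHom.id_apply, smul_comm c (1 / 2 : ℂ)]

end Superfunctions

/-! ### The Schrödinger and the Fock representation -/

section Models

theorem contDiff_coord {n : ℕ} {m : ℕ} (i : Idx m n) :
    ContDiff ℝ ∞ fun x : Fin m → ℝ => (coord i x : Lam n) := by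
  simpa only [mul_one] using contDiff_coord_mul (𝕂 := ℝ) i
    (f := fun _ => (1 : Lam n)) contDiff_const

theorem contDiff_Rsq {n : ℕ} {m : ℕ} : ContDiff ℝ ∞ fun x : Fin m → ℝ => (Rsq x : Lam n) :=
  ContDiff.sum fun i _ => ContDiff.sum fun j _ =>
    (contDiff_coord_mul i (contDiff_coord j)).const_smul _

variable (K : Type*) [Field K] [Algebra K ℂ] (m n : ℕ)

/-- The Schrödinger action `π̃(X)`, `X ∈ spo_K(2m|4n, Ω)`. -/
noncomputable def schrodinger (X : spo K m n) : Module.End ℂ (Smooth ℝ m n) :=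
  metaplectic (X.1.map (algebraMap K ℂ))

/-- The Fock action `ρ̃(X) = π̃_ℂ(c(X))`, `X ∈ spo_K(2m|4n, Ω)`. -/
noncomputable def fock (X : spo K m n) : Module.End ℂ (Smooth ℂ m n) :=
  metaplectic (cayley m n (X.1.map (algebraMap K ℂ)))

/-- The module `U(𝔤) s` generated by a set `s`: the smallest subspace that contains `s` and is
invariant under all operators `ρ(X)`. -/
def generated {g : Type*} {M : Type} [AddCommGroup M] [Module ℂ M] (ρ : g → Module.End ℂ M) (s : Set M) :
    Submodule ℂ M :=
  sInf {W | s ⊆ W ∧ ∀ X, ∀ f ∈ W, ρ X f ∈ W}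

theorem generated_invariant {g : Type*} {M : Type} [AddCommGroup M] [Module ℂ M] (ρ : g → Module.End ℂ M)
    (s : Set M) (X : g) {f : M} (hf : f ∈ generated ρ s) : ρ X f ∈ generated ρ s := by
  rw [generated, Submodule.mem_sInf] at *
  exact fun W hW => hW.2 X f (hf W hW)

theorem generated_sup_invariant {g : Type*} {M : Type} [AddCommGroup M] [Module ℂ M]
    (ρ : g → Module.End ℂ M) (s t : Set M) (X : g) {f : M}
    (hf : f ∈ generated ρ s ⊔ generated ρ t) : ρ X f ∈ generated ρ s ⊔ generated ρ t := by
  obtain ⟨a, ha, b, hb, rfl⟩ := Submodule.mem_sup.1 hf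
  rw [map_add]
  exact Submodule.add_mem_sup (generated_invariant ρ s X ha) (generated_invariant ρ t X hb)

/-- The superfunction `exp(-R²)` on `ℝ^{m|2n}`. -/
noncomputable def expNegRsq : Smooth ℝ m n :=
  ⟨fun x => Grassmann.gexp (-Rsq x), contDiff_gexp contDiff_Rsq.neg⟩

/-- The constant superfunction `1` on `ℂ^{m|2n}`. -/
noncomputable def oneFun : Smooth ℂ m n := ⟨fun _ => 1, by
  change ContDiff ℂ ∞ fun _ : Fin m → ℂ => (1 : Lam n)
  exact contDiff_const⟩

/-- The Schrödinger representation `W̃ = U(𝔤) exp(-R²) + U(𝔤) ℓ_1 exp(-R²)`, where `ℓ_1` is the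
first of the `m + 2n` coordinates (the second summand is zero if there are no coordinates). -/
noncomputable def schrodingerModule : Submodule ℂ (Smooth ℝ m n) :=
  generated (schrodinger K m n) {expNegRsq m n} ⊔
    generated (schrodinger K m n) {f | ∃ i : Idx m n, pos i = 0 ∧ f = mulOp i (expNegRsq m n)}

/-- The Fock representation `F̃ = U(𝔤) 1 + U(𝔤) ℓ_1`. -/
noncomputable def fockModule : Submodule ℂ (Smooth ℂ m n) :=
  generated (fock K m n) {oneFun m n} ⊔
    generated (fock K m n) {f | ∃ i : Idx m n, pos i = 0 ∧ f = mulOp i (oneFun m n)}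

/-- The action `π̃` of `spo_K(2m|4n, Ω)` on `W̃`. -/
noncomputable def schrodingerAction (X : spo K m n) : Module.End ℂ (schrodingerModule K m n) :=
  (schrodinger K m n X).restrict fun _ hf => generated_sup_invariant _ _ _ X hf

/-- The action `ρ̃` of `spo_K(2m|4n, Ω)` on `F̃`. -/
noncomputable def fockAction (X : spo K m n) : Module.End ℂ (fockModule K m n) :=
  (fock K m n X).restrict fun _ hf => generated_sup_invariant _ _ _ X hf

end Models

/-! ### The Segal–Bargmann transform -/

section SegalBargmann

variable {m n : ℕ}

/-- Superfunctions of the odd variables `z`, as superfunctions of `z` and `x`. -/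
noncomputable def embZ : Lam n →ₐ[ℂ] Lam2 n :=
  Grassmann.map (LinearMap.inl ℂ (OddSpace n) (OddSpace n))

/-- Superfunctions of the odd variables `x`, as superfunctions of `z` and `x`. -/
noncomputable def embX : Lam n →ₐ[ℂ] Lam2 n :=
  Grassmann.map (LinearMap.inr ℂ (OddSpace n) (OddSpace n))

/-- The component free of the odd variables `x`: the left inverse of `embZ` that sends the odd
variables `x` to zero. -/
noncomputable def dropX : Lam2 n →ₐ[ℂ] Lam n :=
  Grassmann.map (LinearMap.fst ℂ (OddSpace n) (OddSpace n))

/-- The trace product `z • x = ∑ z^j x_j`, with `z^j = ∑_i z_i β^{ij}`. -/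
noncomputable def traceProd (z : Fin m → ℂ) (x : Fin m → ℝ) : Lam2 n :=
  ∑ i : Idx m n, ∑ j : Idx m n,
    (beta ℂ m n)⁻¹ i j • (embZ (coord i z) * embX (coord j x))

/-- `ω = ∫_{ℝ^{m|2n}} exp(-2R²) dx`. -/
noncomputable def omega (m n : ℕ) : ℂ :=
  Grassmann.body (∫ x : Fin m → ℝ,
    Grassmann.berezin oddForm (Grassmann.gexp (-((2 : ℂ) • Rsq x)) : Lam n))

/-- The integrand `exp(2(z • x)) exp(-R²_x) f(x)` of the Segal–Bargmann transform. -/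
noncomputable def sbIntegrand (f : (Fin m → ℝ) → Lam n) (z : Fin m → ℂ) (x : Fin m → ℝ) :
    Lam2 n :=
  Grassmann.gexp ((2 : ℂ) • traceProd z x) * embX (Grassmann.gexp (-Rsq x)) * embX (f x)

/-- The Segal–Bargmann transform
`SB(f)(z) = ω⁻¹ exp(-½ R²_z) ∫_{ℝ^{m|2n}} exp(2(z • x)) exp(-R²_x) f(x) dx`, where the integral over
`ℝ^{m|2n}` is the Lebesgue integral of the Berezin integral in the odd variables `x`. -/
noncomputable def segalBargmann (f : (Fin m → ℝ) → Lam n) (z : Fin m → ℂ) : Lam n :=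
  (omega m n)⁻¹ • (Grassmann.gexp (-((1 / 2 : ℂ) • Rsq z)) *
    dropX (∫ x : Fin m → ℝ,
      Grassmann.berezin (fun j => oddForm j ∘ₗ LinearMap.snd ℂ (OddSpace n) (OddSpace n))
        (sbIntegrand f z x)))

end SegalBargmann

end SuperSB

/-!
The intertwining property reduces to how the transform treats coordinates and derivatives. On
superfunctions of the form "Gaussian times polynomial" integration by parts in the even and in the
odd variables shows that `SB` turns `ℓ_i` into `½ (ℓ_i + ∂_i)` and `∂_i` into `∂_i - ℓ_i`
(`IsTransform.mulOp`, `IsTransform.partialLow`). The operators `π̃(U_{ab})` are quadratic in the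
`ℓ_i` and `∂_i`, so this linear symplectic substitution acts on them through a matrix
`g = [[1, -i], [-i/2, 1/2]]` (`IsTransform.genOp`). On the other hand the matrices of `e⁺` and `e⁻`
are even and of square zero, hence the Cayley transform is the conjugation by the same `g`, that is
`c(X) Ω⁻¹ = g (X Ω⁻¹) gᵀ` (`cayley_mul_Omega_inv`). Comparing the two gives
`SB (π̃(X) f) = π̃(c(X)) (SB f)` (`IsTransform.metaplectic`).

The integrals are handled by splitting the kernel into its even and its odd part: the transform is
an ordinary Gaussian integral `kernelIntegral`, followed by the purely algebraic `oddTransform` on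
the Grassmann algebra (`segalBargmann_eq`). The even part needs only growth slower than all
Gaussians; this gives integrability, holomorphy in `z`, and integration by parts. The space
`polyGaussian` of Gaussians times polynomials is stable under all operators involved and contains
the Schrödinger module.

The normalization `ω` also factors. Its odd factor is nonzero since otherwise integration by parts
would make the Berezin integral of the Gaussian times anything vanish, although the Gaussian is
invertible and the Berezin integral is not zero (`body_berezin_gexp_ne_zero`). Finally
`(∂_i + 2 ℓ_i) exp(-R²) = 0` goes over into `∂_i F = 0` for the transform `F` of `exp(-R²)`; so `F`
is constant, equal to `1` by the choice of `ω`, and `ℓ_i exp(-R²)` is sent to `½ ℓ_i`. As the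
generators of the Schrödinger module are sent to multiples of those of the Fock module, the whole
module is.
-/

namespace SuperSB

/-! ### Contractions on the Grassmann algebra -/

namespace Grassmann

variable {V W : Type} [AddCommGroup V] [Module ℂ V] [AddCommGroup W] [Module ℂ W]

/-- Induction from the left: the Grassmann algebra is spanned by products of odd generators. -/
theorem left_induction {P : Grassmann V → Prop} (x : Grassmann V)
    (scalar : ∀ r : ℂ, P (algebraMap ℂ (Grassmann V) r))
    (add : ∀ x y, P x → P y → P (x + y)) (gen_mul : ∀ v x, P x → P (gen v * x)) : P x :=
  CliffordAlgebra.left_induction (Q := (0 : QuadraticForm ℂ V)) (P := P) scalar add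
    (fun x v hx => gen_mul v x hx) x

theorem gen_mul_gen (u v : V) : (gen u * gen v : Grassmann V) = -(gen v * gen u) :=
  eq_neg_of_add_eq_zero_left (ExteriorAlgebra.ι_add_mul_swap (R := ℂ) u v)

theorem contract_gen_mul (d : Module.Dual ℂ V) (v : V) (x : Grassmann V) :
    contract d (gen v * x) = d v • x - gen v * contract d x :=
  CliffordAlgebra.contractLeft_ι_mul (Q := (0 : QuadraticForm ℂ V)) (d := d) v x

theorem contract_gen (d : Module.Dual ℂ V) (v : V) :
    contract d (gen v : Grassmann V) = algebraMap ℂ (Grassmann V) (d v) :=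
  CliffordAlgebra.contractLeft_ι (Q := (0 : QuadraticForm ℂ V)) (d := d) v

@[simp]
theorem contract_algebraMap (d : Module.Dual ℂ V) (r : ℂ) :
    contract d (algebraMap ℂ (Grassmann V) r) = 0 :=
  CliffordAlgebra.contractLeft_algebraMap (Q := (0 : QuadraticForm ℂ V)) (d := d) r

@[simp]
theorem contract_one (d : Module.Dual ℂ V) : contract d (1 : Grassmann V) = 0 :=
  CliffordAlgebra.contractLeft_one (Q := (0 : QuadraticForm ℂ V)) (d := d)

theorem contract_contract (d : Module.Dual ℂ V) (x : Grassmann V) :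
    contract d (contract d x) = 0 :=
  CliffordAlgebra.contractLeft_contractLeft (Q := (0 : QuadraticForm ℂ V)) (d := d) x

theorem contract_comm (d d' : Module.Dual ℂ V) (x : Grassmann V) :
    contract d (contract d' x) = -contract d' (contract d x) :=
  CliffordAlgebra.contractLeft_comm (Q := (0 : QuadraticForm ℂ V)) (d := d) (d' := d') x

@[simp]
theorem map_gen (f : V →ₗ[ℂ] W) (v : V) : map f (gen v) = gen (f v) :=
  ExteriorAlgebra.map_apply_ι f v

@[simp]
theorem body_gen (v : V) : body (gen v : Grassmann V) = 0 := by
  change ExteriorAlgebra.algebraMapInv (ExteriorAlgebra.ι ℂ v) = 0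
  simp [ExteriorAlgebra.algebraMapInv]

/-- The odd left derivatives are natural in the space of odd variables. -/
theorem contract_map (f : V →ₗ[ℂ] W) (d : Module.Dual ℂ W) (x : Grassmann V) :
    contract d (map f x) = map f (contract (d ∘ₗ f) x) := by
  induction x using left_induction with
  | scalar r => simp
  | add x y hx hy => simp [hx, hy]
  | gen_mul v x hx => simp [contract_gen_mul, hx]

theorem body_map (f : V →ₗ[ℂ] W) (x : Grassmann V) : body (map f x) = body x := by
  induction x using left_induction with
  | scalar r => simp
  | add x y hx hy => simp [hx, hy]
  | gen_mul v x hx => simp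

theorem contract_zero_form (x : Grassmann V) : contract (0 : Module.Dual ℂ V) x = 0 := by
  induction x using left_induction with
  | scalar r => simp
  | add x y hx hy => simp [hx, hy]
  | gen_mul v x hx => simp [contract_gen_mul, hx]

theorem map_zero_eq (x : Grassmann V) :
    map (0 : V →ₗ[ℂ] V) x = algebraMap ℂ (Grassmann V) (body x) := by
  induction x using left_induction with
  | scalar r => simp
  | add x y hx hy => simp [hx, hy]
  | gen_mul v x hx => simp

/-- If `d v = 1`, then `1 - v ∂_d` is the homomorphism that sets the odd variable `v` to zero and
keeps the kernel of `d`. -/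
theorem sub_gen_mul_contract (d : Module.Dual ℂ V) (v : V) (x : Grassmann V) :
    x - gen v * contract d x = map (LinearMap.id - d.smulRight v) x := by
  induction x using left_induction with
  | scalar r => simp
  | add x y hx hy => rw [map_add, map_add, mul_add, add_sub_add_comm, hx, hy]
  | gen_mul w x hx =>
    have hv : (gen v * gen v : Grassmann V) = 0 := ExteriorAlgebra.ι_sq_zero (R := ℂ) v
    rw [contract_gen_mul, map_mul, ← hx, map_gen, LinearMap.sub_apply, LinearMap.id_apply,
      LinearMap.smulRight_apply, map_sub, map_smul, sub_mul, mul_sub, mul_sub, mul_sub,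
      smul_mul_assoc, smul_mul_assoc, ← mul_assoc, ← mul_assoc, ← mul_assoc, hv, gen_mul_gen w v,
      mul_smul_comm, zero_mul, smul_zero, neg_mul]
    abel

/-! ### Even elements -/

variable (V) in
/-- The subalgebra of the elements that behave like even ones: they are central, and the odd left
derivatives satisfy the Leibniz rule without sign for them. -/
noncomputable def evenElts : Subalgebra ℂ (Grassmann V) where
  carrier := {a | (∀ y, a * y = y * a) ∧
    ∀ d y, contract d (a * y) = contract d a * y + a * contract d y}
  mul_mem' {a b} ha hb := by
    refine ⟨fun y => by rw [mul_assoc, hb.1, ← mul_assoc, ha.1, mul_assoc], fun d y => ?_⟩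
    rw [mul_assoc, ha.2, hb.2, ha.2]
    noncomm_ring
  add_mem' {a b} ha hb := by
    refine ⟨fun y => by rw [add_mul, ha.1, hb.1, mul_add], fun d y => ?_⟩
    rw [add_mul, map_add, ha.2, hb.2, map_add]
    noncomm_ring
  algebraMap_mem' r := by
    refine ⟨fun y => Algebra.commutes r y, fun d y => ?_⟩
    rw [← Algebra.smul_def, map_smul, contract_algebraMap, zero_mul, zero_add, Algebra.smul_def]

theorem evenElts_comm {a : Grassmann V} (ha : a ∈ evenElts V) (y : Grassmann V) :
    a * y = y * a := ha.1 y

theorem contract_evenElts_mul {a : Grassmann V} (ha : a ∈ evenElts V) (d : Module.Dual ℂ V)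
    (y : Grassmann V) : contract d (a * y) = contract d a * y + a * contract d y := ha.2 d y

theorem gen_mul_gen_mem_evenElts (u v : V) : gen u * gen v ∈ evenElts V := by
  constructor
  · intro y
    induction y using left_induction with
    | scalar r => exact (Algebra.commutes r _).symm
    | add x y hx hy => rw [mul_add, hx, hy, add_mul]
    | gen_mul w x hx =>
      have h : gen u * gen v * gen w = gen w * (gen u * gen v) := by
        rw [mul_assoc, gen_mul_gen v w, mul_neg, ← mul_assoc, gen_mul_gen u w, neg_mul, neg_neg,
          mul_assoc]
      rw [← mul_assoc, h, mul_assoc, hx, ← mul_assoc]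
  · intro d y
    rw [mul_assoc, contract_gen_mul, contract_gen_mul, contract_gen_mul, contract_gen, mul_sub,
      sub_mul, smul_mul_assoc, mul_assoc, mul_assoc, ← Algebra.smul_def, mul_smul_comm]
    abel

theorem contract_pow_of_mem {a : Grassmann V} (ha : a ∈ evenElts V) (d : Module.Dual ℂ V)
    (k : ℕ) : contract d (a ^ (k + 1)) = ((k : ℂ) + 1) • (contract d a * a ^ k) := by
  induction k with
  | zero => simp
  | succ k ih =>
    rw [pow_succ', contract_evenElts_mul ha, ih, mul_smul_comm, ← mul_assoc, evenElts_comm ha,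
      mul_assoc, ← pow_succ']
    push_cast
    module

/-! ### Nilpotency of the augmentation ideal and the exponential -/

theorem gen_range_pow_eq_bot [FiniteDimensional ℂ V] :
    LinearMap.range (gen : V →ₗ[ℂ] Grassmann V) ^ (Module.finrank ℂ V + 1) = ⊥ := by
  have h := ExteriorAlgebra.ιMulti_span_fixedDegree (R := ℂ) (M := V) (Module.finrank ℂ V + 1)
  change ((LinearMap.range (ExteriorAlgebra.ι ℂ : V →ₗ[ℂ] ExteriorAlgebra ℂ V)) ^
    (Module.finrank ℂ V + 1)) = ⊥
  refine h.symm.trans (Submodule.span_eq_bot.2 ?_)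
  rintro _ ⟨v, rfl⟩
  refine AlternatingMap.map_linearDependent _ _ fun hv => ?_
  simpa using hv.fintype_card_le_finrank

theorem sub_body_mem (x : Grassmann V) :
    x - algebraMap ℂ (Grassmann V) (body x) ∈
      LinearMap.range (gen : V →ₗ[ℂ] Grassmann V) * (⊤ : Submodule ℂ (Grassmann V)) := by
  induction x using left_induction with
  | scalar r => simp
  | add x y hx hy =>
    rw [map_add, map_add, add_sub_add_comm]
    exact add_mem hx hy
  | gen_mul v x hx =>
    rw [map_mul, body_gen, zero_mul, map_zero, sub_zero]
    exact Submodule.mul_mem_mul ⟨v, rfl⟩ Submodule.mem_top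

theorem top_mul_range_le :
    (⊤ : Submodule ℂ (Grassmann V)) * LinearMap.range (gen : V →ₗ[ℂ] Grassmann V) ≤
      LinearMap.range (gen : V →ₗ[ℂ] Grassmann V) * ⊤ := by
  rw [Submodule.mul_le]
  rintro x - _ ⟨v, rfl⟩
  have h : algebraMap ℂ (Grassmann V) (body x) * gen v ∈
      LinearMap.range (gen : V →ₗ[ℂ] Grassmann V) * (⊤ : Submodule ℂ (Grassmann V)) := by
    rw [Algebra.commutes]
    exact Submodule.mul_mem_mul ⟨v, rfl⟩ Submodule.mem_top
  have h2 : (x - algebraMap ℂ (Grassmann V) (body x)) * gen v ∈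
      LinearMap.range (gen : V →ₗ[ℂ] Grassmann V) * (⊤ : Submodule ℂ (Grassmann V)) := by
    have h3 := Submodule.mul_mem_mul (sub_body_mem x)
      (Submodule.mem_top : gen v ∈ (⊤ : Submodule ℂ (Grassmann V)))
    rw [mul_assoc] at h3
    have h4 : LinearMap.range (gen : V →ₗ[ℂ] Grassmann V) *
        ((⊤ : Submodule ℂ (Grassmann V)) * ⊤) ≤ LinearMap.range (gen : V →ₗ[ℂ] Grassmann V) * ⊤ :=
      mul_le_mul' le_rfl le_top
    exact h4 h3
  have h4 := add_mem h2 h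
  rwa [← add_mul, sub_add_cancel] at h4

/-- The augmentation ideal is nilpotent, of exponent at most the number of odd variables plus
one. -/
theorem sub_body_pow_eq_zero [FiniteDimensional ℂ V] (x : Grassmann V) :
    (x - algebraMap ℂ (Grassmann V) (body x)) ^ (Module.finrank ℂ V + 1) = 0 := by
  have h : ∀ k : ℕ, (x - algebraMap ℂ (Grassmann V) (body x)) ^ k ∈
      LinearMap.range (gen : V →ₗ[ℂ] Grassmann V) ^ k * (⊤ : Submodule ℂ (Grassmann V)) := by
    intro k
    induction k with
    | zero => simp
    | succ k ih =>
      rw [pow_succ, pow_succ]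
      have h1 := Submodule.mul_mem_mul ih (sub_body_mem x)
      have h2 : LinearMap.range (gen : V →ₗ[ℂ] Grassmann V) ^ k * (⊤ : Submodule ℂ (Grassmann V)) *
          (LinearMap.range (gen : V →ₗ[ℂ] Grassmann V) * (⊤ : Submodule ℂ (Grassmann V))) ≤
          LinearMap.range (gen : V →ₗ[ℂ] Grassmann V) ^ k *
            LinearMap.range (gen : V →ₗ[ℂ] Grassmann V) * (⊤ : Submodule ℂ (Grassmann V)) := by
        calc _ = LinearMap.range (gen : V →ₗ[ℂ] Grassmann V) ^ k *
              ((⊤ : Submodule ℂ (Grassmann V)) * LinearMap.range (gen : V →ₗ[ℂ] Grassmann V)) *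
              (⊤ : Submodule ℂ (Grassmann V)) := by simp only [mul_assoc]
          _ ≤ LinearMap.range (gen : V →ₗ[ℂ] Grassmann V) ^ k *
              (LinearMap.range (gen : V →ₗ[ℂ] Grassmann V) * (⊤ : Submodule ℂ (Grassmann V))) *
              (⊤ : Submodule ℂ (Grassmann V)) :=
            mul_le_mul' (mul_le_mul' le_rfl top_mul_range_le) le_rfl
          _ = LinearMap.range (gen : V →ₗ[ℂ] Grassmann V) ^ k *
              LinearMap.range (gen : V →ₗ[ℂ] Grassmann V) *
              ((⊤ : Submodule ℂ (Grassmann V)) * (⊤ : Submodule ℂ (Grassmann V))) := by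
            simp only [mul_assoc]
          _ ≤ _ := mul_le_mul' le_rfl le_top
      exact h2 h1
  have h' := h (Module.finrank ℂ V + 1)
  rw [gen_range_pow_eq_bot, Submodule.bot_mul] at h'
  exact (Submodule.mem_bot ℂ).1 h'

/-- The rational structure with which the nilpotent exponential is formed. -/
noncomputable instance : Module ℚ (Grassmann V) := Module.compHom _ (algebraMap ℚ ℂ)

theorem rat_smul_eq (q : ℚ) (x : Grassmann V) : q • x = (q : ℂ) • x := rfl

theorem gexp_mem_evenElts {a : Grassmann V} (ha : a ∈ evenElts V) : gexp a ∈ evenElts V :=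
  Subalgebra.smul_mem _ (sum_mem fun _ _ => Subalgebra.smul_mem _
    (pow_mem (sub_mem ha (Subalgebra.algebraMap_mem _ _)) _) _) _

section FiniteDimensional

variable [FiniteDimensional ℂ V] [FiniteDimensional ℂ W]

theorem isNilpotent_of_body {a : Grassmann V} (ha : body a = 0) : IsNilpotent a := by
  refine ⟨Module.finrank ℂ V + 1, ?_⟩
  simpa [ha] using sub_body_pow_eq_zero a

theorem gexp_of_body_eq_zero {a : Grassmann V} (ha : body a = 0) :
    gexp a = IsNilpotent.exp a := by
  have h := sub_body_pow_eq_zero a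
  rw [ha, map_zero, sub_zero] at h
  rw [IsNilpotent.exp_eq_sum h, gexp, ha, Complex.exp_zero, one_smul, map_zero, sub_zero]
  refine Finset.sum_congr rfl fun k _ => ?_
  rw [rat_smul_eq]
  push_cast
  rfl

theorem gexp_add_scalar (r : ℂ) {a : Grassmann V} (ha : body a = 0) :
    gexp (r • (1 : Grassmann V) + a) = Complex.exp r • gexp a := by
  have h : body (r • (1 : Grassmann V) + a) = r := by simp [ha]
  rw [gexp, gexp, h, ha, Complex.exp_zero, one_smul, Algebra.algebraMap_eq_smul_one,
    add_sub_cancel_left, map_zero, sub_zero]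

theorem gexp_mul_self {a : Grassmann V} (ha : body a = 0) :
    gexp a * gexp a = gexp ((2 : ℂ) • a) := by
  have h2 : body ((2 : ℂ) • a) = 0 := by simp [ha]
  rw [gexp_of_body_eq_zero ha, gexp_of_body_eq_zero h2, two_smul,
    IsNilpotent.exp_add_of_commute (Commute.refl a) (isNilpotent_of_body ha)
      (isNilpotent_of_body ha)]

theorem gexp_mul_gexp_neg {a : Grassmann V} (ha : body a = 0) : gexp a * gexp (-a) = 1 := by
  rw [gexp_of_body_eq_zero ha, gexp_of_body_eq_zero (by simp [ha]),
    IsNilpotent.exp_mul_exp_neg_self (isNilpotent_of_body ha)]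

@[simp]
theorem gexp_zero : gexp (0 : Grassmann V) = 1 := by
  rw [gexp_of_body_eq_zero (map_zero _), IsNilpotent.exp_zero]

theorem map_gexp (f : V →ₗ[ℂ] W) {a : Grassmann V} (ha : body a = 0) :
    map f (gexp a) = gexp (map f a) := by
  rw [gexp_of_body_eq_zero ha, gexp_of_body_eq_zero (by rw [body_map, ha]),
    IsNilpotent.map_exp (isNilpotent_of_body ha)]

theorem body_gexp {a : Grassmann V} (ha : body a = 0) : body (gexp a) = 1 := by
  rw [gexp_of_body_eq_zero ha, IsNilpotent.map_exp (isNilpotent_of_body ha), ha,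
    IsNilpotent.exp_zero]

/-- The chain rule for odd left derivatives of the exponential of an even element. -/
theorem contract_gexp {a : Grassmann V} (ha : a ∈ evenElts V) (hb : body a = 0)
    (d : Module.Dual ℂ V) : contract d (gexp a) = contract d a * gexp a := by
  obtain ⟨k, hk⟩ := isNilpotent_of_body hb
  -- one more term in the exponential series changes nothing, and makes the two sides match
  have hk' : a ^ (k + 1) = 0 := by rw [pow_succ, hk, zero_mul]
  rw [gexp_of_body_eq_zero hb]
  conv_lhs => rw [IsNilpotent.exp_eq_sum hk']
  rw [IsNilpotent.exp_eq_sum hk, Finset.sum_range_succ', map_add, map_sum, Finset.mul_sum]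
  simp only [rat_smul_eq, map_smul, contract_pow_of_mem ha, pow_zero, contract_one, smul_zero,
    add_zero, mul_smul_comm, smul_smul]
  refine Finset.sum_congr rfl fun j _ => ?_
  congr 1
  rw [Nat.factorial_succ]
  push_cast
  have h1 : (j : ℂ) + 1 ≠ 0 := Nat.cast_add_one_ne_zero j
  have h2 : (j.factorial : ℂ) ≠ 0 := by exact_mod_cast j.factorial_ne_zero
  field_simp

end FiniteDimensional

end Grassmann

open Grassmann in
/-- A Grassmann number killed by the derivatives along all coordinates is a scalar. -/
theorem eq_body_of_contract_eq_zero {n : ℕ} (x : Lam n)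
    (hx : ∀ j, contract (oddForm j) x = 0) : x = algebraMap ℂ (Lam n) (body x) := by
  let p : Finset (Fin (2 * n)) → OddSpace n →ₗ[ℂ] OddSpace n := fun s =>
    LinearMap.pi fun j => if j ∈ s then 0 else LinearMap.proj j
  have h : ∀ s, x = map (p s) x := by
    intro s
    induction s using Finset.induction_on with
    | empty =>
      have h0 : p ∅ = LinearMap.id := by ext; simp [p]
      rw [h0]
      exact (DFunLike.congr_fun (ExteriorAlgebra.map_id (R := ℂ) (M := OddSpace n)) x).symm
    | insert i s hi ih =>
      have h1 := sub_gen_mul_contract (oddForm i) (oddVec i) x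
      rw [hx i, mul_zero, sub_zero] at h1
      have h2 : p (insert i s) = p s ∘ₗ (LinearMap.id - (oddForm i).smulRight (oddVec i)) := by
        refine LinearMap.ext fun v => funext fun j => ?_
        by_cases hj : j ∈ s
        · simp [p, hj]
        · by_cases hij : j = i
          · subst hij
            simp [p, oddForm, oddVec, hi]
          · simp [p, oddVec, hj, hij]
      have h3 : map (p (insert i s)) x =
          map (p s) (map (LinearMap.id - (oddForm i).smulRight (oddVec i)) x) := by
        rw [h2]
        exact (DFunLike.congr_fun (ExteriorAlgebra.map_comp_map (R := ℂ)
          (LinearMap.id - (oddForm i).smulRight (oddVec i)) (p s)) x).symm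
      rw [h3, ← h1]
      exact ih
  have hp : p Finset.univ = 0 := by ext; simp [p]
  rw [← map_zero_eq, ← hp]
  exact h _

/-! ### The odd block of the supersymmetric form -/

/-- The odd block `[[0, -I_n], [I_n, 0]]` of `β`. -/
def oddBeta (n : ℕ) : Matrix (Fin (2 * n)) (Fin (2 * n)) ℂ :=
  Matrix.of fun j k => if k.val = j.val + n then -1 else if j.val = k.val + n then 1 else 0

theorem beta_eq_fromBlocks (m n : ℕ) : beta ℂ m n = Matrix.fromBlocks 1 0 0 (oddBeta n) := rfl

theorem oddBeta_swap {n : ℕ} (j k : Fin (2 * n)) : oddBeta n k j = -oddBeta n j k := by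
  simp only [oddBeta, Matrix.of_apply]
  split_ifs <;> first | omega | simp

theorem oddBeta_mul_transpose (n : ℕ) : oddBeta n * (oddBeta n).transpose = 1 := by
  -- row `j` has a single nonzero entry, in the column `k` paired with `j`
  have key : ∀ j : Fin (2 * n), ∃ (k : Fin (2 * n)) (s : ℂ), s * s = 1 ∧
      (∀ l, oddBeta n j l = if l = k then s else 0) ∧
      (k.val = j.val + n ∨ j.val = k.val + n) := by
    intro j
    by_cases hj : j.val < n
    · refine ⟨⟨j.val + n, by omega⟩, -1, by norm_num, fun l => ?_, Or.inl rfl⟩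
      simp only [oddBeta, Matrix.of_apply, Fin.ext_iff]
      split_ifs <;> first | omega | rfl
    · refine ⟨⟨j.val - n, by omega⟩, 1, by norm_num, fun l => ?_, Or.inr ?_⟩
      · simp only [oddBeta, Matrix.of_apply, Fin.ext_iff]
        split_ifs <;> first | omega | rfl
      · simp only []; omega
  ext i l
  obtain ⟨k, s, hs, hk, hik⟩ := key i
  obtain ⟨k', s', hs', hk', hlk⟩ := key l
  rw [Matrix.mul_apply]
  simp only [Matrix.transpose_apply, hk, hk', ite_mul, zero_mul, Finset.sum_ite_eq',
    Finset.mem_univ, if_true, Matrix.one_apply]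
  have := i.isLt; have := l.isLt; have := k.isLt; have := k'.isLt
  by_cases h : i = l
  · subst h
    have h1 := hk k
    rw [hk' k, if_pos rfl] at h1
    rw [h1, if_pos rfl, hs]
  · rw [if_neg h, if_neg, mul_zero]
    intro hkk
    subst hkk
    apply h
    rw [Fin.ext_iff]
    omega

theorem beta_inv (m n : ℕ) :
    (beta ℂ m n)⁻¹ = Matrix.fromBlocks 1 0 0 (oddBeta n).transpose := by
  refine Matrix.inv_eq_right_inv ?_
  rw [beta_eq_fromBlocks, Matrix.fromBlocks_multiply]
  simp [oddBeta_mul_transpose]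

theorem sum_oddBeta_mul_oddBeta {n : ℕ} (i l : Fin (2 * n)) :
    ∑ k, oddBeta n i k * oddBeta n l k = if i = l then 1 else 0 := by
  have h := congrFun (congrFun (oddBeta_mul_transpose n) i) l
  rwa [Matrix.mul_apply, Matrix.one_apply] at h

theorem sum_oddBeta_mul {M : Type*} [AddCommGroup M] [Module ℂ M] {n : ℕ} (i : Fin (2 * n))
    (f : Fin (2 * n) → M) :
    ∑ k, oddBeta n i k • ∑ l, oddBeta n l k • f l = f i := by
  simp only [Finset.smul_sum, smul_smul]
  rw [Finset.sum_comm]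
  simp only [← Finset.sum_smul, sum_oddBeta_mul_oddBeta, ite_smul,
    one_smul, zero_smul, Finset.sum_ite_eq, Finset.mem_univ, if_true]

namespace Grassmann

variable {V W : Type} [AddCommGroup V] [Module ℂ V] [AddCommGroup W] [Module ℂ W] {n : ℕ}

/-- The even element `∑ β^{jk} u_j v_k`, for two families of odd variables. -/
noncomputable def pairing (u v : Fin (2 * n) → V) : Grassmann V :=
  ∑ j, ∑ k, oddBeta n k j • (gen (u j) * gen (v k))

theorem pairing_mem_evenElts (u v : Fin (2 * n) → V) : pairing u v ∈ evenElts V :=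
  sum_mem fun _ _ => sum_mem fun _ _ => Subalgebra.smul_mem _ (gen_mul_gen_mem_evenElts _ _) _

@[simp]
theorem body_pairing (u v : Fin (2 * n) → V) : body (pairing u v) = 0 := by
  simp [pairing]

@[simp]
theorem map_pairing (f : V →ₗ[ℂ] W) (u v : Fin (2 * n) → V) :
    map f (pairing u v) = pairing (f ∘ u) (f ∘ v) := by
  simp [pairing]

/-- The odd derivatives `∑_k β_{jk} ∂_k` with lowered index, for a family of linear forms. -/
noncomputable def lowContract (d : Fin (2 * n) → Module.Dual ℂ V) (j : Fin (2 * n)) :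
    Module.End ℂ (Grassmann V) :=
  ∑ k, oddBeta n j k • contract (d k)

theorem lowContract_apply (d : Fin (2 * n) → Module.Dual ℂ V) (j : Fin (2 * n))
    (x : Grassmann V) : lowContract d j x = ∑ k, oddBeta n j k • contract (d k) x := by
  simp [lowContract]

/-- The derivative with lowered index of `∑ β^{jk} u_j v_k`, for a derivative under which `u` and `v`
are proportional to the dual basis: the two matrices `β` cancel. -/
theorem lowContract_pairing (d : Fin (2 * n) → Module.Dual ℂ V) (u v : Fin (2 * n) → V) (p q : ℂ)
    (hu : ∀ k j, d k (u j) = if j = k then p else 0)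
    (hv : ∀ k j, d k (v j) = if j = k then q else 0) (i : Fin (2 * n)) :
    lowContract d i (pairing u v) = p • gen (v i) + q • gen (u i) := by
  have h : ∀ k, contract (d k) (pairing u v) =
      ∑ l, oddBeta n l k • (p • gen (v l) + q • gen (u l)) := by
    intro k
    simp only [pairing, map_sum, map_smul, contract_gen_mul, contract_gen, hu, hv, smul_add,
      Finset.sum_add_distrib, sub_eq_add_neg]
    congr 1
    · rw [Finset.sum_comm]
      simp only [ite_smul, zero_smul, smul_ite, smul_zero, Finset.sum_ite_eq', Finset.mem_univ,
        if_true]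
    · refine Finset.sum_congr rfl fun l _ => ?_
      rw [Finset.sum_eq_single k]
      · rw [if_pos rfl, ← Algebra.commutes, ← Algebra.smul_def, oddBeta_swap l k, neg_smul,
          smul_neg, neg_neg]
      · intro j _ hj
        rw [if_neg hj, map_zero, mul_zero, neg_zero, smul_zero]
      · simp
  rw [lowContract_apply]
  simp only [h]
  exact sum_oddBeta_mul i fun l => p • gen (v l) + q • gen (u l)

theorem lowContract_mul {a : Grassmann V} (ha : a ∈ evenElts V)
    (d : Fin (2 * n) → Module.Dual ℂ V) (j : Fin (2 * n)) (y : Grassmann V) :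
    lowContract d j (a * y) = lowContract d j a * y + a * lowContract d j y := by
  simp only [lowContract_apply, contract_evenElts_mul ha, smul_add, Finset.sum_add_distrib,
    Finset.sum_mul, Finset.mul_sum, smul_mul_assoc, mul_smul_comm]

theorem lowContract_gexp [FiniteDimensional ℂ V] {a : Grassmann V} (ha : a ∈ evenElts V)
    (hb : body a = 0) (d : Fin (2 * n) → Module.Dual ℂ V) (j : Fin (2 * n)) :
    lowContract d j (gexp a) = lowContract d j a * gexp a := by
  simp only [lowContract_apply, contract_gexp ha hb, Finset.sum_mul, smul_mul_assoc]

theorem lowContract_map (f : V →ₗ[ℂ] W) (d : Fin (2 * n) → Module.Dual ℂ W) (j : Fin (2 * n))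
    (x : Grassmann V) :
    lowContract d j (map f x) = map f (lowContract (fun k => d k ∘ₗ f) j x) := by
  simp only [lowContract_apply, contract_map, map_sum, map_smul]

/-! ### The Berezin integral -/

/-- A composition of odd left derivatives. -/
noncomputable def contractList (l : List (Module.Dual ℂ V)) : Module.End ℂ (Grassmann V) :=
  (l.map contract).prod

theorem contractList_cons (d : Module.Dual ℂ V) (l : List (Module.Dual ℂ V)) (x : Grassmann V) :
    contractList (d :: l) x = contract d (contractList l x) := by
  simp [contractList]

@[simp]
theorem contractList_nil (x : Grassmann V) : contractList [] x = x := by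
  simp [contractList]

theorem contractList_gen_mul (l : List (Module.Dual ℂ V)) (v : V) (hl : ∀ d ∈ l, d v = 0)
    (x : Grassmann V) :
    contractList l (gen v * x) = (-1 : ℂ) ^ l.length • (gen v * contractList l x) := by
  induction l with
  | nil => simp
  | cons d l ih =>
    rw [contractList_cons, contractList_cons, ih fun e he => hl e (List.mem_cons_of_mem _ he),
      map_smul, contract_gen_mul, hl d List.mem_cons_self, List.length_cons, pow_succ]
    module

theorem contractList_contract (l : List (Module.Dual ℂ V)) (e : Module.Dual ℂ V)
    (x : Grassmann V) :
    contractList l (contract e x) = (-1 : ℂ) ^ l.length • contract e (contractList l x) := by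
  induction l with
  | nil => simp
  | cons d l ih =>
    rw [contractList_cons, contractList_cons, ih, map_smul, contract_comm d e, List.length_cons,
      pow_succ]
    module

theorem contractList_contract_of_mem (l : List (Module.Dual ℂ V)) (e : Module.Dual ℂ V)
    (he : e ∈ l) (x : Grassmann V) : contractList l (contract e x) = 0 := by
  induction l with
  | nil => simp at he
  | cons d l ih =>
    rw [contractList_cons]
    rcases List.mem_cons.1 he with rfl | h
    · rw [contractList_contract, map_smul, contract_contract, smul_zero]
    · rw [ih h, map_zero]

theorem contractList_map (f : V →ₗ[ℂ] W) (l : List (Module.Dual ℂ W)) (x : Grassmann V) :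
    contractList l (map f x) = map f (contractList (l.map fun d => d ∘ₗ f) x) := by
  induction l with
  | nil => simp
  | cons d l ih => rw [contractList_cons, ih, contract_map, List.map_cons, contractList_cons]

theorem neg_one_pow_length (d : Fin (2 * n) → Module.Dual ℂ V) :
    (-1 : ℂ) ^ ((List.finRange (2 * n)).reverse.map d).length = 1 := by
  simp

variable [FiniteDimensional ℂ V] [FiniteDimensional ℂ W]

theorem berezin_apply (d : Fin (2 * n) → Module.Dual ℂ V) (x : Grassmann V) :
    berezin d x = ((Real.pi : ℂ) ^ n)⁻¹ •
      contractList ((List.finRange (2 * n)).reverse.map d) x := by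
  rw [berezin, contractList, List.map_map]
  rfl

theorem berezin_gen_mul (d : Fin (2 * n) → Module.Dual ℂ V) (v : V) (hd : ∀ j, d j v = 0)
    (x : Grassmann V) : berezin d (gen v * x) = gen v * berezin d x := by
  rw [berezin_apply, berezin_apply, contractList_gen_mul _ _ (by simpa using hd),
    neg_one_pow_length, one_smul, mul_smul_comm]

theorem berezin_contract (d : Fin (2 * n) → Module.Dual ℂ V) (e : Module.Dual ℂ V)
    (x : Grassmann V) : berezin d (contract e x) = contract e (berezin d x) := by
  rw [berezin_apply, berezin_apply, contractList_contract, neg_one_pow_length, one_smul, map_smul]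

theorem berezin_contract_self (d : Fin (2 * n) → Module.Dual ℂ V) (j : Fin (2 * n))
    (x : Grassmann V) : berezin d (contract (d j) x) = 0 := by
  rw [berezin_apply, contractList_contract_of_mem _ _ (by simp), smul_zero]

theorem berezin_map (f : V →ₗ[ℂ] W) (d : Fin (2 * n) → Module.Dual ℂ W) (x : Grassmann V) :
    berezin d (map f x) = map f (berezin (fun j => d j ∘ₗ f) x) := by
  rw [berezin_apply, berezin_apply, contractList_map, map_smul, List.map_map]
  rfl

theorem berezin_lowContract (d e : Fin (2 * n) → Module.Dual ℂ V) (j : Fin (2 * n))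
    (x : Grassmann V) : berezin d (lowContract e j x) = lowContract e j (berezin d x) := by
  simp only [lowContract_apply, map_sum, map_smul, berezin_contract]

theorem berezin_lowContract_self (d : Fin (2 * n) → Module.Dual ℂ V) (j : Fin (2 * n))
    (x : Grassmann V) : berezin d (lowContract d j x) = 0 := by
  simp only [lowContract_apply, map_sum, map_smul, berezin_contract_self, smul_zero,
    Finset.sum_const_zero]

end Grassmann

open Grassmann

/-! ### The odd part of the Segal–Bargmann transform -/

section OddTransform

variable {n : ℕ}

/-- The part `∑ β^{jk} θ_j θ_k` of `R²` in the odd variables. -/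
noncomputable def oddRsq (n : ℕ) : Lam n := pairing oddVec oddVec

/-- The derivative `∂_j = ∑_k β_{jk} ∂/∂θ_k` on the Grassmann algebra. -/
noncomputable def oddLow (j : Fin (2 * n)) : Module.End ℂ (Lam n) := lowContract oddForm j

theorem oddForm_oddVec (k j : Fin (2 * n)) : oddForm k (oddVec j) = if j = k then 1 else 0 := by
  simp [oddForm, oddVec, Pi.single_apply, eq_comm]

theorem gen_eq_sum (v : OddSpace n) : (gen v : Lam n) = ∑ j, v j • gen (oddVec j) := by
  have h : v = ∑ j, v j • oddVec j := by
    funext k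
    simp [oddVec, Pi.single_apply]
  conv_lhs => rw [h]
  rw [map_sum]
  simp only [map_smul]

theorem smul_oddRsq_mem (c : ℂ) : c • oddRsq n ∈ evenElts (OddSpace n) :=
  Subalgebra.smul_mem _ (pairing_mem_evenElts _ _) _

@[simp]
theorem body_smul_oddRsq (c : ℂ) : body (c • oddRsq n) = 0 := by
  simp [oddRsq]

theorem oddLow_gexp_mul (c : ℂ) (j : Fin (2 * n)) (y : Lam n) :
    oddLow j (gexp (c • oddRsq n) * y) =
      (2 * c) • (gen (oddVec j) * (gexp (c • oddRsq n) * y)) +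
        gexp (c • oddRsq n) * oddLow j y := by
  rw [oddLow, lowContract_mul (gexp_mem_evenElts (smul_oddRsq_mem c)),
    lowContract_gexp (smul_oddRsq_mem c) (body_smul_oddRsq c), map_smul, oddRsq,
    lowContract_pairing oddForm oddVec oddVec 1 1 oddForm_oddVec oddForm_oddVec, one_smul,
    ← two_smul ℂ, smul_smul, mul_comm c 2, smul_mul_assoc, smul_mul_assoc, mul_assoc]

theorem contract_oddForm_eq (j : Fin (2 * n)) (x : Lam n) :
    contract (oddForm j) x = ∑ k, oddBeta n k j • oddLow k x := by
  simp only [oddLow, lowContract_apply, Finset.smul_sum, smul_smul]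
  rw [Finset.sum_comm]
  have h : ∀ k, ∑ i, oddBeta n i j * oddBeta n i k = if j = k then 1 else 0 := by
    intro k
    rw [← sum_oddBeta_mul_oddBeta j k]
    refine Finset.sum_congr rfl fun i _ => ?_
    rw [oddBeta_swap j i, oddBeta_swap k i, neg_mul_neg]
  simp only [← Finset.sum_smul, h, ite_smul, one_smul, zero_smul, Finset.sum_ite_eq,
    Finset.mem_univ, if_true]

/-! ### The Berezin integral of the Gaussian -/

theorem contractList_prod_gen (l : List (Fin (2 * n))) (hl : l.Nodup) :
    contractList (l.reverse.map oddForm) ((l.map fun j => gen (oddVec j)).prod : Lam n) = 1 := by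
  have hz : ∀ (a : Fin (2 * n)) (l : List (Fin (2 * n))), a ∉ l →
      contract (oddForm a) ((l.map fun j => gen (oddVec j)).prod : Lam n) = 0 := by
    intro a l
    induction l with
    | nil => simp
    | cons b l ih =>
      intro h
      rw [List.mem_cons, not_or] at h
      rw [List.map_cons, List.prod_cons, contract_gen_mul, oddForm_oddVec, if_neg (Ne.symm h.1),
        ih h.2, zero_smul, mul_zero, sub_zero]
  induction l with
  | nil => simp
  | cons a l ih =>
    rw [List.nodup_cons] at hl
    have happ : ∀ (xs : List (Module.Dual ℂ (OddSpace n))) (d : Module.Dual ℂ (OddSpace n))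
        (y : Lam n), contractList (xs ++ [d]) y = contractList xs (contract d y) := by
      intro xs d y
      simp [contractList]
    rw [List.reverse_cons, List.map_append, List.map_singleton, happ, List.map_cons,
      List.prod_cons, contract_gen_mul, oddForm_oddVec, if_pos rfl, hz a l hl.1, one_smul,
      mul_zero, sub_zero, ih hl.2]

theorem berezin_oddForm_ne_zero : (berezin oddForm : Module.End ℂ (Lam n)) ≠ 0 := by
  intro h
  have h1 := LinearMap.congr_fun h ((List.finRange (2 * n)).map fun j => gen (oddVec j)).prod
  rw [berezin_apply, contractList_prod_gen _ (List.nodup_finRange _), LinearMap.zero_apply] at h1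
  have h2 := congrArg body h1
  simp at h2

/-- The Gaussian has a nonzero Berezin integral: otherwise integration by parts would show that
the integral of the Gaussian times any polynomial vanishes, but the Gaussian is invertible. -/
theorem body_berezin_gexp_ne_zero :
    body (berezin oddForm (gexp (-((2 : ℂ) • oddRsq n))) : Lam n) ≠ 0 := by
  rw [← neg_smul]
  set E : Lam n := gexp ((-2 : ℂ) • oddRsq n) with hE
  intro h0
  have hDE : berezin oddForm E = 0 := by
    rw [eq_body_of_contract_eq_zero (berezin oddForm E), h0, map_zero]
    intro j
    rw [← berezin_contract, berezin_contract_self]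
  have hparts : ∀ (j : Fin (2 * n)) (w : Lam n), berezin oddForm (E * oddLow j w) = 0 →
      berezin oddForm (E * (gen (oddVec j) * w)) = 0 := by
    intro j w h2
    have h3 := oddLow_gexp_mul (-2) j w
    rw [← hE] at h3
    have h4 := congrArg (berezin oddForm) h3
    rw [oddLow, berezin_lowContract_self, map_add, map_smul, ← oddLow, h2, add_zero] at h4
    rw [← mul_assoc, evenElts_comm (gexp_mem_evenElts (smul_oddRsq_mem _)), mul_assoc]
    exact (smul_eq_zero.1 h4.symm).resolve_left (by norm_num)
  -- every element lies in a subspace that is stable under derivatives and killed by the functional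
  have key : ∀ x : Lam n, ∃ S : Submodule ℂ (Lam n), x ∈ S ∧
      (∀ d, ∀ w ∈ S, contract d w ∈ S) ∧ ∀ w ∈ S, berezin oddForm (E * w) = 0 := by
    intro x
    induction x using left_induction with
    | scalar r =>
      refine ⟨Submodule.span ℂ {1}, ?_, ?_, ?_⟩
      · rw [Algebra.algebraMap_eq_smul_one]
        exact Submodule.smul_mem _ _ (Submodule.mem_span_singleton_self _)
      · intro d w hw
        obtain ⟨c, rfl⟩ := Submodule.mem_span_singleton.1 hw
        simp
      · intro w hw
        obtain ⟨c, rfl⟩ := Submodule.mem_span_singleton.1 hw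
        simp [hDE]
    | add x y hx hy =>
      obtain ⟨S, hxS, hS1, hS2⟩ := hx
      obtain ⟨T, hyT, hT1, hT2⟩ := hy
      refine ⟨S ⊔ T, Submodule.add_mem_sup hxS hyT, ?_, ?_⟩
      · intro d w hw
        obtain ⟨a, ha, b, hb, rfl⟩ := Submodule.mem_sup.1 hw
        rw [map_add]
        exact Submodule.add_mem_sup (hS1 d a ha) (hT1 d b hb)
      · intro w hw
        obtain ⟨a, ha, b, hb, rfl⟩ := Submodule.mem_sup.1 hw
        rw [mul_add, map_add, hS2 a ha, hT2 b hb, add_zero]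
    | gen_mul v x hx =>
      obtain ⟨S, hxS, hS1, hS2⟩ := hx
      have hlow : ∀ j, ∀ w ∈ S, oddLow j w ∈ S := by
        intro j w hw
        rw [oddLow, lowContract_apply]
        exact Submodule.sum_mem _ fun k _ => Submodule.smul_mem _ _ (hS1 _ w hw)
      refine ⟨S ⊔ LinearMap.range (gen : OddSpace n →ₗ[ℂ] Lam n) * S,
        Submodule.mem_sup_right (Submodule.mul_mem_mul ⟨v, rfl⟩ hxS), ?_, ?_⟩
      · intro d w hw
        obtain ⟨a, ha, b, hb, rfl⟩ := Submodule.mem_sup.1 hw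
        rw [map_add]
        refine add_mem (Submodule.mem_sup_left (hS1 d a ha)) ?_
        refine Submodule.mul_induction_on hb ?_ fun p q hp hq => by
          rw [map_add]; exact add_mem hp hq
        rintro _ ⟨u, rfl⟩ w hw
        rw [contract_gen_mul]
        exact sub_mem (Submodule.mem_sup_left (Submodule.smul_mem _ _ hw))
          (Submodule.mem_sup_right (Submodule.mul_mem_mul ⟨u, rfl⟩ (hS1 d w hw)))
      · intro w hw
        obtain ⟨a, ha, b, hb, rfl⟩ := Submodule.mem_sup.1 hw
        rw [mul_add, map_add, hS2 a ha, zero_add]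
        refine Submodule.mul_induction_on hb ?_ fun p q hp hq => by
          rw [mul_add, map_add, hp, hq, add_zero]
        rintro _ ⟨u, rfl⟩ w hw
        rw [gen_eq_sum u]
        simp only [Finset.sum_mul, Finset.mul_sum, map_sum, smul_mul_assoc, mul_smul_comm, map_smul,
          hparts _ w (hS2 _ (hlow _ w hw)), smul_zero, Finset.sum_const_zero]
  apply berezin_oddForm_ne_zero (n := n)
  refine LinearMap.ext fun y => ?_
  obtain ⟨S, hy, -, hS⟩ := key (gexp (-((-2 : ℂ) • oddRsq n)) * y)
  have h := hS _ hy
  rwa [← mul_assoc, hE, gexp_mul_gexp_neg (body_smul_oddRsq _), one_mul] at h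

/-! ### The odd integral kernel -/

/-- The odd variables `z` in `Λ(z, x)`. -/
noncomputable def zVec (j : Fin (2 * n)) : OddSpace n × OddSpace n := (oddVec j, 0)

/-- The odd variables `x` in `Λ(z, x)`. -/
noncomputable def xVec (j : Fin (2 * n)) : OddSpace n × OddSpace n := (0, oddVec j)

/-- The coordinate forms dual to the odd variables `z`. -/
noncomputable def zForm (j : Fin (2 * n)) : Module.Dual ℂ (OddSpace n × OddSpace n) :=
  oddForm j ∘ₗ LinearMap.fst ℂ (OddSpace n) (OddSpace n)

/-- The coordinate forms dual to the odd variables `x`. -/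
noncomputable def xForm (j : Fin (2 * n)) : Module.Dual ℂ (OddSpace n × OddSpace n) :=
  oddForm j ∘ₗ LinearMap.snd ℂ (OddSpace n) (OddSpace n)

/-- The odd part `exp(2 ∑ β^{jk} z_j x_k) exp(-∑ β^{jk} x_j x_k)` of the kernel of the
Segal–Bargmann transform. -/
noncomputable def oddKernel (n : ℕ) : Lam2 n :=
  gexp ((2 : ℂ) • pairing zVec xVec) * embX (gexp ((-1 : ℂ) • oddRsq n))

/-- The integral transform with the odd kernel, without the factor in `z`. -/
noncomputable def oddIntegral : Module.End ℂ (Lam n) :=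
  dropX.toLinearMap ∘ₗ berezin xForm ∘ₗ LinearMap.mulLeft ℂ (oddKernel n) ∘ₗ embX.toLinearMap

theorem oddIntegral_apply (φ : Lam n) :
    oddIntegral φ = dropX (berezin xForm (oddKernel n * embX φ)) := rfl

/-- The odd part of the Segal–Bargmann transform, up to the normalization. -/
noncomputable def oddTransform : Module.End ℂ (Lam n) :=
  LinearMap.mulLeft ℂ (gexp ((-(1 / 2) : ℂ) • oddRsq n)) ∘ₗ oddIntegral

theorem oddTransform_apply (φ : Lam n) :
    oddTransform φ = gexp ((-(1 / 2) : ℂ) • oddRsq n) * oddIntegral φ := rfl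

theorem embX_gexp (c : ℂ) :
    embX (gexp (c • oddRsq n)) = gexp (c • pairing (n := n) xVec xVec) := by
  rw [embX, map_gexp _ (body_smul_oddRsq c), map_smul, oddRsq, map_pairing]
  rfl

theorem oddKernel_eq : oddKernel n =
    gexp ((2 : ℂ) • pairing zVec xVec) * gexp ((-1 : ℂ) • pairing (n := n) xVec xVec) := by
  rw [oddKernel, embX_gexp]

theorem smul_pairing_mem {V : Type} [AddCommGroup V] [Module ℂ V] (c : ℂ)
    (u v : Fin (2 * n) → V) : c • pairing u v ∈ evenElts V :=
  Subalgebra.smul_mem _ (pairing_mem_evenElts _ _) _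

theorem body_smul_pairing {V : Type} [AddCommGroup V] [Module ℂ V] (c : ℂ)
    (u v : Fin (2 * n) → V) : body (c • pairing u v) = 0 := by simp

theorem oddKernel_mem_evenElts : oddKernel n ∈ evenElts (OddSpace n × OddSpace n) := by
  rw [oddKernel_eq]
  exact mul_mem (gexp_mem_evenElts (smul_pairing_mem _ _ _))
    (gexp_mem_evenElts (smul_pairing_mem _ _ _))

theorem lowContract_oddKernel (d : Fin (2 * n) → Module.Dual ℂ (OddSpace n × OddSpace n))
    (p q : ℂ) (hz : ∀ k j, d k (zVec j) = if j = k then p else 0)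
    (hx : ∀ k j, d k (xVec j) = if j = k then q else 0) (j : Fin (2 * n)) :
    lowContract d j (oddKernel n) =
      ((2 * p - 2 * q) • gen (xVec j) + (2 * q) • gen (zVec j)) * oddKernel n := by
  rw [oddKernel_eq, lowContract_mul (gexp_mem_evenElts (smul_pairing_mem _ _ _)),
    lowContract_gexp (smul_pairing_mem _ _ _) (body_smul_pairing _ _ _),
    lowContract_gexp (smul_pairing_mem _ _ _) (body_smul_pairing _ _ _), map_smul, map_smul,
    lowContract_pairing d zVec xVec p q hz hx, lowContract_pairing d xVec xVec q q hx hx,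
    ← mul_assoc, evenElts_comm (gexp_mem_evenElts (smul_pairing_mem 2 _ _)), mul_assoc, mul_assoc,
    ← add_mul]
  congr 1
  module

theorem zForm_zVec (k j : Fin (2 * n)) : zForm k (zVec j) = if j = k then (1 : ℂ) else 0 :=
  oddForm_oddVec k j

theorem zForm_xVec (k j : Fin (2 * n)) : zForm k (xVec j) = if j = k then (0 : ℂ) else 0 := by
  simp [zForm, xVec]

theorem xForm_xVec (k j : Fin (2 * n)) : xForm k (xVec j) = if j = k then (1 : ℂ) else 0 :=
  oddForm_oddVec k j

theorem xForm_zVec (k j : Fin (2 * n)) : xForm k (zVec j) = if j = k then (0 : ℂ) else 0 := by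
  simp [xForm, zVec]

theorem lowContract_zForm_embX (j : Fin (2 * n)) (φ : Lam n) :
    lowContract zForm j (embX φ) = 0 := by
  rw [embX, lowContract_map]
  have h : (fun k : Fin (2 * n) => zForm k ∘ₗ LinearMap.inr ℂ (OddSpace n) (OddSpace n)) = 0 := by
    funext k; ext; simp [zForm]
  rw [h, lowContract_apply]
  simp [contract_zero_form]

theorem lowContract_xForm_embX (j : Fin (2 * n)) (φ : Lam n) :
    lowContract xForm j (embX φ) = embX (oddLow j φ) := by
  rw [embX, lowContract_map]
  rfl

theorem oddLow_dropX (j : Fin (2 * n)) (x : Lam2 n) :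
    oddLow j (dropX x) = dropX (lowContract zForm j x) := by
  rw [dropX, oddLow, lowContract_map]
  rfl

theorem embX_gen (j : Fin (2 * n)) : embX (gen (oddVec j) : Lam n) = gen (xVec j) := by
  simp [embX, xVec]

theorem dropX_gen_zVec (j : Fin (2 * n)) : dropX (gen (zVec j)) = (gen (oddVec j) : Lam n) := by
  simp [dropX, zVec]

theorem oddLow_oddIntegral (j : Fin (2 * n)) (φ : Lam n) :
    oddLow j (oddIntegral φ) = (2 : ℂ) • oddIntegral (gen (oddVec j) * φ) := by
  rw [oddIntegral_apply, oddLow_dropX, ← berezin_lowContract, lowContract_mul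
    oddKernel_mem_evenElts, lowContract_zForm_embX, mul_zero, add_zero,
    lowContract_oddKernel zForm 1 0 zForm_zVec zForm_xVec, oddIntegral_apply, map_mul embX,
    embX_gen]
  simp only [mul_zero, sub_zero, mul_one, zero_smul, add_zero, smul_mul_assoc, map_smul]
  rw [← mul_assoc (oddKernel n), evenElts_comm oddKernel_mem_evenElts]

/-- Integration by parts in the odd variables: the Berezin integral of a derivative vanishes. -/
theorem oddIntegral_oddLow (j : Fin (2 * n)) (φ : Lam n) :
    oddIntegral (oddLow j φ) = (2 : ℂ) • oddIntegral (gen (oddVec j) * φ) -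
      (2 : ℂ) • (gen (oddVec j) * oddIntegral φ) := by
  have h := berezin_lowContract_self xForm j (oddKernel n * embX φ)
  rw [lowContract_mul oddKernel_mem_evenElts, lowContract_xForm_embX,
    lowContract_oddKernel xForm 0 1 xForm_zVec xForm_xVec] at h
  have h2 := congrArg dropX h
  simp only [mul_zero, zero_sub, mul_one, add_mul, smul_mul_assoc, map_add, map_smul,
    mul_assoc] at h2
  rw [berezin_gen_mul _ (zVec j) (fun k => by rw [xForm_zVec, ite_self]), map_mul dropX,
    dropX_gen_zVec,
    ← oddIntegral_apply, ← oddIntegral_apply, ← mul_assoc (gen (xVec j)),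
    ← evenElts_comm oddKernel_mem_evenElts, mul_assoc, ← embX_gen, ← map_mul embX,
    ← oddIntegral_apply, map_zero] at h2
  rw [← sub_eq_zero, ← h2]
  module

theorem oddTransform_gen_mul (j : Fin (2 * n)) (φ : Lam n) :
    oddTransform (gen (oddVec j) * φ) =
      (1 / 2 : ℂ) • (gen (oddVec j) * oddTransform φ + oddLow j (oddTransform φ)) := by
  simp only [oddTransform_apply, oddLow_gexp_mul, oddLow_oddIntegral, mul_smul_comm]
  module

theorem oddTransform_oddLow (j : Fin (2 * n)) (φ : Lam n) :
    oddTransform (oddLow j φ) = oddLow j (oddTransform φ) - gen (oddVec j) * oddTransform φ := by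
  have hc : gexp ((-(1 / 2) : ℂ) • oddRsq n) * (gen (oddVec j) * oddIntegral φ) =
      gen (oddVec j) * (gexp ((-(1 / 2) : ℂ) • oddRsq n) * oddIntegral φ) := by
    rw [← mul_assoc, evenElts_comm (gexp_mem_evenElts (smul_oddRsq_mem _)), mul_assoc]
  simp only [oddTransform_apply, oddLow_gexp_mul, oddLow_oddIntegral, oddIntegral_oddLow, mul_sub,
    mul_smul_comm, hc]
  module

/-- At `z = 0` the odd transform of the Gaussian is the odd factor of `ω`. -/
theorem body_oddTransform :
    body (oddTransform (gexp ((-1 : ℂ) • oddRsq n))) =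
      body (berezin oddForm (gexp (-((2 : ℂ) • oddRsq n))) : Lam n) := by
  have hz : (LinearMap.snd ℂ (OddSpace n) (OddSpace n)) ∘ zVec = 0 := by
    funext j; simp [zVec]
  have hx : (LinearMap.snd ℂ (OddSpace n) (OddSpace n)) ∘ xVec = oddVec := by
    funext j; simp [xVec]
  have hp : ∀ v : Fin (2 * n) → OddSpace n, pairing 0 v = 0 := by
    intro v; simp [pairing]
  rw [oddTransform_apply, map_mul, body_gexp (body_smul_oddRsq _), one_mul, oddIntegral_apply,
    dropX, body_map, ← body_map (LinearMap.snd ℂ (OddSpace n) (OddSpace n))]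
  have h := berezin_map (LinearMap.snd ℂ (OddSpace n) (OddSpace n)) oddForm
    (oddKernel n * embX (gexp ((-1 : ℂ) • oddRsq n)))
  change _ = map _ (berezin xForm _) at h
  rw [← h, embX_gexp, oddKernel_eq, map_mul (map _), map_mul (map _),
    map_gexp _ (body_smul_pairing _ _ _), map_gexp _ (body_smul_pairing _ _ _), map_smul,
    map_smul, map_pairing, map_pairing, hz, hx, hp,
    smul_zero, gexp_zero, one_mul, gexp_mul_self (body_smul_pairing _ _ _), smul_smul,
    ← neg_smul, oddRsq]
  norm_num

end OddTransform

/-! ### Commutation relations of coordinates and derivatives -/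

section Operators

variable {𝕂 : Type} [RCLike 𝕂] [NormedAlgebra 𝕂 ℂ] {m n : ℕ}

theorem mul_coord_inl (i : Fin m) (x : Fin m → 𝕂) (y : Lam n) :
    coord (Sum.inl i) x * y = algebraMap 𝕂 ℂ (x i) • y := by
  simp [coord]

theorem Rsq_eq (x : Fin m → 𝕂) :
    (Rsq x : Lam n) = (∑ i, algebraMap 𝕂 ℂ (x i) ^ 2) • (1 : Lam n) + oddRsq n := by
  simp only [Rsq, beta_inv, Fintype.sum_sum_type, Matrix.fromBlocks_apply₁₁,
    Matrix.fromBlocks_apply₁₂, Matrix.fromBlocks_apply₂₁, Matrix.fromBlocks_apply₂₂,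
    Matrix.zero_apply, zero_smul, Finset.sum_const_zero, add_zero, zero_add, Matrix.one_apply,
    ite_smul, one_smul, Finset.sum_ite_eq, Finset.mem_univ, if_true, Matrix.transpose_apply,
    oddRsq, pairing, Finset.sum_smul]
  congr 1
  refine Finset.sum_congr rfl fun i _ => ?_
  rw [mul_coord_inl, coord, Sum.elim_inl, smul_smul, sq]

variable [NormedSpace 𝕂 (Lam n)] [IsScalarTower 𝕂 ℂ (Lam n)]

theorem smooth_ext {f g : Smooth 𝕂 m n} (h : ∀ x, f.1 x = g.1 x) : f = g :=
  Subtype.ext (funext h)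

theorem smooth_contDiff (f : Smooth 𝕂 m n) : ContDiff 𝕂 ∞ f.1 := f.2

theorem mulOp_inl_apply (i : Fin m) (f : Smooth 𝕂 m n) (x : Fin m → 𝕂) :
    (mulOp (Sum.inl i) f).1 x = algebraMap 𝕂 ℂ (x i) • f.1 x :=
  mul_coord_inl i x _

theorem mulOp_inr_apply (j : Fin (2 * n)) (f : Smooth 𝕂 m n) (x : Fin m → 𝕂) :
    (mulOp (Sum.inr j) f).1 x = gen (oddVec j) * f.1 x := rfl

theorem evenDeriv_apply (i : Fin m) (f : Smooth 𝕂 m n) (x : Fin m → 𝕂) :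
    (evenDeriv i f).1 x = fderiv 𝕂 f.1 x (Pi.single i 1) := rfl

theorem oddDeriv_apply (j : Fin (2 * n)) (f : Smooth 𝕂 m n) (x : Fin m → 𝕂) :
    (oddDeriv j f).1 x = contract (oddForm j) (f.1 x) := rfl

theorem partialLow_inl (i : Fin m) :
    (partialLow (Sum.inl i) : Module.End ℂ (Smooth 𝕂 m n)) = evenDeriv i := by
  rw [partialLow, Fintype.sum_sum_type]
  simp [beta_eq_fromBlocks, Matrix.one_apply]

theorem partialLow_inr_apply (j : Fin (2 * n)) (f : Smooth 𝕂 m n) (x : Fin m → 𝕂) :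
    (partialLow (Sum.inr j) f).1 x = oddLow j (f.1 x) := by
  rw [partialLow, Fintype.sum_sum_type, oddLow, lowContract_apply]
  simp [beta_eq_fromBlocks, oddDeriv_apply]

/-- Constant linear operators on the Grassmann algebra commute with the derivatives along even
coordinates. -/
theorem fderiv_linear_comp (L : Module.End ℂ (Lam n)) (f : Smooth 𝕂 m n) (x v : Fin m → 𝕂) :
    fderiv 𝕂 (fun y => L (f.1 y)) x v = L (fderiv 𝕂 f.1 x v) := by
  have h := ((LinearMap.toContinuousLinearMap L).restrictScalars 𝕂).hasFDerivAt.comp x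
    (smooth_differentiableAt f x).hasFDerivAt
  have h2 := h.fderiv
  change fderiv 𝕂 (fun y => L (f.1 y)) x = _ at h2
  rw [h2]
  rfl

theorem evenDeriv_mulOp_inl (i k : Fin m) (f : Smooth 𝕂 m n) :
    evenDeriv i (mulOp (Sum.inl k) f) =
      (if i = k then (1 : ℂ) else 0) • f + mulOp (Sum.inl k) (evenDeriv i f) := by
  refine smooth_ext fun x => ?_
  have hc : HasFDerivAt (fun y : Fin m → 𝕂 => algebraMap 𝕂 ℂ (y k))
      ((algebraMapCLM 𝕂 ℂ).comp (ContinuousLinearMap.proj k)) x :=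
    ((algebraMapCLM 𝕂 ℂ).comp (ContinuousLinearMap.proj (R := 𝕂) (φ := fun _ : Fin m => 𝕂)
      k)).hasFDerivAt
  have h := hc.smul (smooth_differentiableAt f x).hasFDerivAt
  have h1 : (mulOp (Sum.inl k) f).1 = fun y => algebraMap 𝕂 ℂ (y k) • f.1 y :=
    funext fun y => mulOp_inl_apply k f y
  rw [evenDeriv_apply, h1]
  erw [h.fderiv]
  change _ = (if i = k then (1 : ℂ) else 0) • f.1 x + (mulOp (Sum.inl k) (evenDeriv i f)).1 x
  rw [mulOp_inl_apply, evenDeriv_apply]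
  by_cases hik : i = k
  · subst hik
    simp [add_comm]
  · simp [hik, Ne.symm hik]

theorem partialLow_mulOp (i j : Idx m n) (f : Smooth 𝕂 m n) :
    partialLow i (mulOp j f) =
      beta ℂ m n i j • f + (-1 : ℂ) ^ (par i * par j) • mulOp j (partialLow i f) := by
  rcases i with i | i <;> rcases j with j | j
  · rw [partialLow_inl, evenDeriv_mulOp_inl]
    simp [beta_eq_fromBlocks, par, Matrix.one_apply]
  · refine smooth_ext fun x => ?_
    rw [partialLow_inl]
    have h := fderiv_linear_comp (LinearMap.mulLeft ℂ (gen (oddVec j) : Lam n)) f x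
      (Pi.single i 1)
    simp only [beta_eq_fromBlocks, Matrix.fromBlocks_apply₁₂, Matrix.zero_apply, zero_smul,
      zero_add, par, Sum.elim_inl, Sum.elim_inr, zero_mul, pow_zero, one_smul]
    exact h
  · refine smooth_ext fun x => ?_
    rw [partialLow_inr_apply, mulOp_inl_apply, map_smul]
    have h : (partialLow (Sum.inr i) f).1 x = oddLow i (f.1 x) := partialLow_inr_apply i f x
    have h2 := mulOp_inl_apply j (partialLow (Sum.inr i) f) x
    simp [beta_eq_fromBlocks, par, h, h2]
  · refine smooth_ext fun x => ?_
    have h : ((beta ℂ m n (Sum.inr i) (Sum.inr j) • f +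
        (-1 : ℂ) ^ (par (m := m) (Sum.inr i) * par (m := m) (Sum.inr j)) •
          mulOp (Sum.inr j) (partialLow (Sum.inr i) f) : Smooth 𝕂 m n)).1 x =
        oddBeta n i j • f.1 x + (-1 : ℂ) • (gen (oddVec j) * oddLow i (f.1 x)) := by
      rw [← partialLow_inr_apply]
      simp [beta_eq_fromBlocks, par, mulOp_inr_apply]
    rw [h, partialLow_inr_apply, mulOp_inr_apply, oddLow, lowContract_apply, lowContract_apply]
    simp only [contract_gen_mul, oddForm_oddVec, smul_sub, Finset.sum_sub_distrib, ite_smul,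
      one_smul, zero_smul, smul_ite, smul_zero, Finset.sum_ite_eq, Finset.mem_univ, if_true,
      Finset.mul_sum, mul_smul_comm]
    module

theorem mulOp_comm (i j : Idx m n) (f : Smooth 𝕂 m n) :
    mulOp i (mulOp j f) = (-1 : ℂ) ^ (par i * par j) • mulOp j (mulOp i f) := by
  refine smooth_ext fun x => ?_
  change coord i x * (coord j x * f.1 x) =
    (-1 : ℂ) ^ (par i * par j) • (coord j x * (coord i x * f.1 x))
  rcases i with i | i <;> rcases j with j | j
  · simp only [mul_coord_inl, par, Sum.elim_inl, mul_zero, pow_zero, one_smul]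
    rw [smul_comm]
  · simp only [mul_coord_inl, par, Sum.elim_inl, Sum.elim_inr, zero_mul, pow_zero, one_smul,
      mul_smul_comm]
  · simp only [mul_coord_inl, par, Sum.elim_inl, Sum.elim_inr, mul_zero, pow_zero, one_smul,
      mul_smul_comm]
  · simp only [coord, par, Sum.elim_inr, mul_one, pow_one]
    rw [← mul_assoc, gen_mul_gen, neg_mul, neg_one_smul, mul_assoc]

theorem oddLow_comm (i j : Fin (2 * n)) (y : Lam n) :
    oddLow i (oddLow j y) = -oddLow j (oddLow i y) := by
  simp only [oddLow, lowContract_apply, map_sum, map_smul, Finset.smul_sum]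
  rw [Finset.sum_comm, ← Finset.sum_neg_distrib]
  refine Finset.sum_congr rfl fun k _ => ?_
  rw [← Finset.sum_neg_distrib]
  refine Finset.sum_congr rfl fun l _ => ?_
  rw [contract_comm, smul_neg, smul_neg, smul_comm]

theorem evenDeriv_comm (i j : Fin m) (f : Smooth 𝕂 m n) :
    evenDeriv i (evenDeriv j f) = evenDeriv j (evenDeriv i f) := by
  refine smooth_ext fun x => ?_
  have hf := smooth_contDiff f
  have hs : IsSymmSndFDerivAt 𝕂 f.1 x :=
    hf.contDiffAt.isSymmSndFDerivAt (by
      rw [minSmoothness_of_isRCLikeNormedField]; exact WithTop.coe_le_coe.2 le_top)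
  have hd : DifferentiableAt 𝕂 (fderiv 𝕂 f.1) x :=
    ((hf.fderiv_right (m := ∞) le_rfl).differentiable (by simp)) x
  have h : ∀ a b : Fin m, (evenDeriv a (evenDeriv b f)).1 x =
      fderiv 𝕂 (fderiv 𝕂 f.1) x (Pi.single a 1) (Pi.single b 1) := by
    intro a b
    change fderiv 𝕂 (fun y => fderiv 𝕂 f.1 y (Pi.single b 1)) x (Pi.single a 1) = _
    rw [fderiv_clm_apply hd (differentiableAt_const _)]
    simp
  rw [h, h]
  exact hs _ _

theorem partialLow_comm (i j : Idx m n) (f : Smooth 𝕂 m n) :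
    partialLow i (partialLow j f) =
      (-1 : ℂ) ^ (par i * par j) • partialLow j (partialLow i f) := by
  have hmix : ∀ (i : Fin m) (j : Fin (2 * n)), partialLow (Sum.inl i) (partialLow (Sum.inr j) f) =
      partialLow (Sum.inr j) (partialLow (Sum.inl i) f) := by
    intro i j
    refine smooth_ext fun x => ?_
    rw [partialLow_inl, partialLow_inr_apply, evenDeriv_apply, evenDeriv_apply,
      ← fderiv_linear_comp]
    congr 2
    funext y
    exact partialLow_inr_apply j f y
  rcases i with i | i <;> rcases j with j | j
  · rw [partialLow_inl, partialLow_inl, evenDeriv_comm]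
    simp [par]
  · rw [hmix]
    simp [par]
  · rw [hmix]
    simp [par]
  · refine smooth_ext fun x => ?_
    have h : ∀ a b : Fin (2 * n), (partialLow (Sum.inr a) (partialLow (Sum.inr b) f)).1 x =
        oddLow a (oddLow b (f.1 x)) := by
      intro a b
      rw [partialLow_inr_apply, partialLow_inr_apply]
    have h2 : (((-1 : ℂ) ^ (par (m := m) (Sum.inr i) * par (m := m) (Sum.inr j)) •
        partialLow (Sum.inr j) (partialLow (Sum.inr i) f) : Smooth 𝕂 m n)).1 x =
        -oddLow j (oddLow i (f.1 x)) := by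
      rw [← h]
      simp [par]
    rw [h, h2, oddLow_comm]

end Operators

theorem traceProd_eq {m n : ℕ} (z : Fin m → ℂ) (x : Fin m → ℝ) :
    traceProd (n := n) z x = (∑ i, z i * x i) • (1 : Lam2 n) + pairing zVec xVec := by
  simp only [traceProd, beta_inv, Fintype.sum_sum_type, Matrix.fromBlocks_apply₁₁,
    Matrix.fromBlocks_apply₁₂, Matrix.fromBlocks_apply₂₁, Matrix.fromBlocks_apply₂₂,
    Matrix.zero_apply, zero_smul, Finset.sum_const_zero, add_zero, zero_add, Matrix.one_apply,
    ite_smul, one_smul, Finset.sum_ite_eq, Finset.mem_univ, if_true, Matrix.transpose_apply,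
    pairing, Finset.sum_smul]
  congr 1
  · refine Finset.sum_congr rfl fun i _ => ?_
    simp only [coord, Sum.elim_inl, map_smul, map_one, smul_mul_smul_comm, mul_one]
    rfl
  · refine Finset.sum_congr rfl fun i _ => Finset.sum_congr rfl fun j _ => ?_
    simp [coord, embZ, embX, zVec, xVec]

/-! ### Gaussian integrals depending on a complex parameter -/

section Gaussian

variable {m : ℕ} {E : Type*} [NormedAddCommGroup E]

/-- The even part `exp(2 z·x - |x|²)` of the kernel of the Segal–Bargmann transform. -/
noncomputable def kernel (z : Fin m → ℂ) (x : Fin m → ℝ) : ℂ :=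
  Complex.exp (2 * ∑ i, z i * x i - ∑ i, (x i : ℂ) ^ 2)

/-- Functions that grow slower than every Gaussian `exp(t |x|²)`, `t > 0`. -/
def SubgaussianGrowth (f : (Fin m → ℝ) → E) : Prop :=
  ∀ t > 0, ∃ C, 0 ≤ C ∧ ∀ x, ‖f x‖ ≤ C * Real.exp (t * ∑ i, x i ^ 2)

theorem SubgaussianGrowth.add {f g : (Fin m → ℝ) → E} (hf : SubgaussianGrowth f)
    (hg : SubgaussianGrowth g) : SubgaussianGrowth (f + g) := by
  intro t ht
  obtain ⟨C, hC, hf⟩ := hf t ht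
  obtain ⟨D, hD, hg⟩ := hg t ht
  refine ⟨C + D, add_nonneg hC hD, fun x => ?_⟩
  rw [add_mul]
  exact (norm_add_le _ _).trans (add_le_add (hf x) (hg x))

variable [NormedSpace ℂ E]

/-- The integral of a function against the kernel `exp(2 z·x - |x|²)`. -/
noncomputable def kernelIntegral (f : (Fin m → ℝ) → E) (z : Fin m → ℂ) : E :=
  ∫ x, kernel z x • f x

theorem SubgaussianGrowth.const_smul {f : (Fin m → ℝ) → E} (hf : SubgaussianGrowth f) (c : ℂ) :
    SubgaussianGrowth (c • f) := by
  intro t ht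
  obtain ⟨C, hC, hf⟩ := hf t ht
  refine ⟨‖c‖ * C, by positivity, fun x => ?_⟩
  rw [Pi.smul_apply, norm_smul, mul_assoc]
  exact mul_le_mul_of_nonneg_left (hf x) (norm_nonneg _)

theorem SubgaussianGrowth.coord_smul {f : (Fin m → ℝ) → E} (hf : SubgaussianGrowth f)
    (i : Fin m) : SubgaussianGrowth fun x => (x i : ℂ) • f x := by
  intro t ht
  obtain ⟨C, hC, hf⟩ := hf (t / 2) (by positivity)
  refine ⟨(1 + 2 / t) * C, by positivity, fun x => ?_⟩
  have h1 : |x i| ≤ (1 + 2 / t) * Real.exp (t / 2 * ∑ j, x j ^ 2) := by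
    have h2 : x i ^ 2 ≤ ∑ j, x j ^ 2 :=
      Finset.single_le_sum (f := fun j => x j ^ 2) (fun j _ => sq_nonneg _) (Finset.mem_univ i)
    have h3 := Real.add_one_le_exp (t / 2 * ∑ j, x j ^ 2)
    have h4 : t / 2 * x i ^ 2 ≤ t / 2 * ∑ j, x j ^ 2 :=
      mul_le_mul_of_nonneg_left h2 (by positivity)
    have h5 : |x i| ≤ 1 + x i ^ 2 := by
      nlinarith [sq_abs (x i), sq_nonneg (|x i| - 1), abs_nonneg (x i)]
    have h6 : 1 + x i ^ 2 ≤ (1 + 2 / t) * (t / 2 * x i ^ 2 + 1) := by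
      have : (1 + 2 / t) * (t / 2 * x i ^ 2 + 1) = t / 2 * x i ^ 2 + 1 + x i ^ 2 + 2 / t := by
        field_simp
        ring
      rw [this]
      have : 0 ≤ t / 2 * x i ^ 2 := by positivity
      have : 0 ≤ 2 / t := by positivity
      linarith
    calc |x i| ≤ (1 + 2 / t) * (t / 2 * x i ^ 2 + 1) := h5.trans h6
      _ ≤ _ := mul_le_mul_of_nonneg_left (by linarith) (by positivity)
  have h2 : t * ∑ j, x j ^ 2 = t / 2 * ∑ j, x j ^ 2 + t / 2 * ∑ j, x j ^ 2 := by ring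
  rw [norm_smul, Complex.norm_real, Real.norm_eq_abs, h2, Real.exp_add]
  calc |x i| * ‖f x‖ ≤ ((1 + 2 / t) * Real.exp (t / 2 * ∑ j, x j ^ 2)) *
        (C * Real.exp (t / 2 * ∑ j, x j ^ 2)) :=
        mul_le_mul h1 (hf x) (norm_nonneg _) (by positivity)
    _ = _ := by ring

theorem norm_kernel_le (z : Fin m → ℂ) {c : ℝ} (hz : ∀ i, ‖z i‖ ≤ c) (x : Fin m → ℝ) :
    ‖kernel z x‖ ≤ Real.exp (m * (4 * c ^ 2)) * Real.exp (-(3 / 4) * ∑ i, x i ^ 2) := by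
  rw [kernel, Complex.norm_exp, ← Real.exp_add]
  refine Real.exp_le_exp.2 ?_
  have h : (2 * ∑ i, z i * (x i : ℂ) - ∑ i, (x i : ℂ) ^ 2).re =
      ∑ i, (2 * ((z i).re * x i) - x i ^ 2) := by
    rw [Finset.sum_sub_distrib, ← Finset.mul_sum, Complex.sub_re]
    congr 1
    · simp
    · rw [Complex.re_sum]
      refine Finset.sum_congr rfl fun i _ => ?_
      rw [← Complex.ofReal_pow, Complex.ofReal_re]
  have h2 : (m : ℝ) * (4 * c ^ 2) = ∑ _i : Fin m, 4 * c ^ 2 := by simp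
  rw [h, h2, Finset.mul_sum, ← Finset.sum_add_distrib]
  refine Finset.sum_le_sum fun i _ => ?_
  have h3 : |(z i).re| ≤ c := (Complex.abs_re_le_norm _).trans (hz i)
  have h4 : (z i).re ^ 2 ≤ c ^ 2 := by
    rw [← sq_abs]
    exact pow_le_pow_left₀ (abs_nonneg _) h3 2
  nlinarith [sq_nonneg (2 * (z i).re - x i / 2)]

theorem exists_norm_kernel_smul_le {f : (Fin m → ℝ) → E} (hf : SubgaussianGrowth f) (c : ℝ) :
    ∃ C, ∀ z : Fin m → ℂ, (∀ i, ‖z i‖ ≤ c) → ∀ x,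
      ‖kernel z x • f x‖ ≤ C * Real.exp (-(1 / 2) * ∑ i, x i ^ 2) := by
  obtain ⟨C, hC, hf⟩ := hf (1 / 4) (by norm_num)
  refine ⟨Real.exp (m * (4 * c ^ 2)) * C, fun z hz x => ?_⟩
  have h : (-(1 / 2) : ℝ) * ∑ i, x i ^ 2 =
      -(3 / 4) * ∑ i, x i ^ 2 + 1 / 4 * ∑ i, x i ^ 2 := by ring
  rw [norm_smul, h, Real.exp_add]
  calc ‖kernel z x‖ * ‖f x‖ ≤ (Real.exp (m * (4 * c ^ 2)) * Real.exp (-(3 / 4) * ∑ i, x i ^ 2)) *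
        (C * Real.exp (1 / 4 * ∑ i, x i ^ 2)) :=
        mul_le_mul (norm_kernel_le z hz x) (hf x) (norm_nonneg _) (by positivity)
    _ = _ := by ring

theorem integrable_exp_neg_sq : Integrable fun x : Fin m → ℝ =>
    Real.exp (-(1 / 2) * ∑ i, x i ^ 2) := by
  have h := (GaussianFourier.integrable_cexp_neg_mul_sum_add (ι := Fin m) (b := 1 / 2)
    (by norm_num) 0).norm
  refine h.congr (Filter.Eventually.of_forall fun x => ?_)
  simp only [Pi.zero_apply, zero_mul, Finset.sum_const_zero, add_zero]
  rw [Complex.norm_exp]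
  congr 1
  have : (-(1 / 2) * ∑ i, (x i : ℂ) ^ 2) = ((-(1 / 2) * ∑ i, x i ^ 2 : ℝ) : ℂ) := by push_cast; rfl
  rw [this, Complex.ofReal_re]

@[fun_prop]
theorem continuous_kernel (z : Fin m → ℂ) : Continuous (kernel z) := by
  unfold kernel
  fun_prop

/-- The factor `exp(-|x|²)` of the kernel dominates the growth of `f`. -/
theorem integrable_kernel_smul {f : (Fin m → ℝ) → E} (hc : Continuous f)
    (hf : SubgaussianGrowth f) (z : Fin m → ℂ) : Integrable fun x => kernel z x • f x := by
  obtain ⟨C, hC⟩ := exists_norm_kernel_smul_le hf ‖z‖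
  refine Integrable.mono' (integrable_exp_neg_sq.const_mul C)
    ((continuous_kernel z).smul hc).aestronglyMeasurable
    (Filter.Eventually.of_forall fun x => hC z (norm_le_pi_norm z) x)

theorem hasFDerivAt_kernel (z : Fin m → ℂ) (x : Fin m → ℝ) :
    HasFDerivAt (fun z => kernel z x) (kernel z x • ((2 : ℂ) • ∑ i, (x i : ℂ) •
      (ContinuousLinearMap.proj i : (Fin m → ℂ) →L[ℂ] ℂ))) z := by
  have h : HasFDerivAt (fun z : Fin m → ℂ => ∑ i, z i * (x i : ℂ))
      (∑ i, (x i : ℂ) • (ContinuousLinearMap.proj i : (Fin m → ℂ) →L[ℂ] ℂ)) z :=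
    HasFDerivAt.fun_sum fun i _ => (ContinuousLinearMap.proj (R := ℂ)
      (φ := fun _ : Fin m => ℂ) i).hasFDerivAt.mul_const (x i : ℂ)
  exact ((h.const_mul 2).sub_const _).cexp

/-- Differentiation under the integral sign. -/
theorem hasFDerivAt_kernelIntegral [CompleteSpace E] {f : (Fin m → ℝ) → E} (hc : Continuous f)
    (hf : SubgaussianGrowth f) (z₀ : Fin m → ℂ) :
    HasFDerivAt (kernelIntegral f) (∑ i, (ContinuousLinearMap.proj i :
      (Fin m → ℂ) →L[ℂ] ℂ).smulRight ((2 : ℂ) • kernelIntegral (fun x => (x i : ℂ) • f x) z₀))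
      z₀ := by
  obtain ⟨A, hA, hA'⟩ : ∃ A : Fin m → E →L[ℂ] (Fin m → ℂ) →L[ℂ] E, (∀ i e v, A i e v = v i • e) ∧
      ∀ i e, (ContinuousLinearMap.proj i : (Fin m → ℂ) →L[ℂ] ℂ).smulRight e = A i e :=
    ⟨fun i => ContinuousLinearMap.smulRightL ℂ (Fin m → ℂ) E (ContinuousLinearMap.proj i),
      fun _ _ _ => rfl, fun _ _ => rfl⟩
  have hnorm : ∀ i e, ‖A i e‖ ≤ ‖e‖ := fun i e => by
    refine ContinuousLinearMap.opNorm_le_bound _ (norm_nonneg _) fun v => ?_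
    rw [hA, norm_smul, mul_comm]
    exact mul_le_mul_of_nonneg_left (norm_le_pi_norm v i) (norm_nonneg _)
  have hci : ∀ i, Continuous fun x : Fin m → ℝ => (x i : ℂ) • f x := fun i => by fun_prop
  have hi : ∀ i, Integrable fun x : Fin m → ℝ => (2 : ℂ) • (kernel z₀ x • ((x i : ℂ) • f x)) :=
    fun i => (integrable_kernel_smul (hci i) (hf.coord_smul i) z₀).smul (2 : ℂ)
  have hint : ∀ i, Integrable fun x : Fin m → ℝ =>
      A i ((2 : ℂ) • (kernel z₀ x • ((x i : ℂ) • f x))) := fun i => (A i).integrable_comp (hi i)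
  choose C hC using fun i => exists_norm_kernel_smul_le (hf.coord_smul i) (‖z₀‖ + 1)
  have hmeas : AEStronglyMeasurable (fun x : Fin m → ℝ =>
      ∑ i, A i ((2 : ℂ) • (kernel z₀ x • ((x i : ℂ) • f x)))) volume :=
    (continuous_finsetSum _ fun i _ => (A i).continuous.comp
      (((continuous_kernel z₀).smul (hci i)).const_smul (2 : ℂ))).aestronglyMeasurable
  have hbound : ∀ (x : Fin m → ℝ), ∀ z ∈ Metric.ball z₀ 1,
      ‖∑ i, A i ((2 : ℂ) • (kernel z x • ((x i : ℂ) • f x)))‖ ≤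
        (∑ i, 2 * C i) * Real.exp (-(1 / 2) * ∑ i, x i ^ 2) := by
    intro x z hz
    have hz' : ∀ i, ‖z i‖ ≤ ‖z₀‖ + 1 := by
      intro i
      have h1 := norm_le_pi_norm z i
      have h2 : ‖z - z₀‖ < 1 := by rwa [← dist_eq_norm]
      have h3 := norm_le_norm_add_norm_sub' z z₀
      linarith
    rw [Finset.sum_mul]
    refine (norm_sum_le _ _).trans (Finset.sum_le_sum fun i _ => (hnorm i _).trans ?_)
    have h4 := hC i z hz' x
    have h5 : ‖(2 : ℂ)‖ = 2 := by norm_num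
    rw [norm_smul, h5]
    linarith
  have hdiff : ∀ (x : Fin m → ℝ) (z : Fin m → ℂ), HasFDerivAt (fun z => kernel z x • f x)
      (∑ i, A i ((2 : ℂ) • (kernel z x • ((x i : ℂ) • f x)))) z := by
    intro x z
    refine ((hasFDerivAt_kernel z x).smul_const (f x)).congr_fderiv ?_
    ext v
    simp only [hA, ContinuousLinearMap.smulRight_apply, smul_apply, sum_apply,
      ContinuousLinearMap.proj_apply, smul_eq_mul, Finset.mul_sum, Finset.sum_smul, smul_smul]
    refine Finset.sum_congr rfl fun i _ => ?_
    congr 1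
    ring
  have key := hasFDerivAt_integral_of_dominated_of_fderiv_le (𝕜 := ℂ)
    (F := fun z x => kernel z x • f x) (Metric.ball_mem_nhds z₀ one_pos)
    (Filter.Eventually.of_forall fun z => ((continuous_kernel z).smul hc).aestronglyMeasurable)
    (integrable_kernel_smul hc hf z₀) hmeas (Filter.Eventually.of_forall hbound)
    (integrable_exp_neg_sq.const_mul _) (Filter.Eventually.of_forall fun x z _ => hdiff x z)
  refine HasFDerivAt.congr_fderiv key ?_
  rw [integral_finsetSum _ fun i _ => hint i]
  refine Finset.sum_congr rfl fun i _ => ?_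
  rw [hA', (A i).integral_comp_comm (hi i), integral_smul]
  rfl

theorem fderiv_kernelIntegral [CompleteSpace E] {f : (Fin m → ℝ) → E} (hc : Continuous f)
    (hf : SubgaussianGrowth f) (z : Fin m → ℂ) (i : Fin m) :
    fderiv ℂ (kernelIntegral f) z (Pi.single i 1) =
      (2 : ℂ) • kernelIntegral (fun x => (x i : ℂ) • f x) z := by
  rw [(hasFDerivAt_kernelIntegral hc hf z).fderiv, sum_apply,
    Finset.sum_eq_single i]
  · simp
  · intro j _ hj
    simp [hj]
  · simp

theorem contDiff_kernelIntegral [CompleteSpace E] {f : (Fin m → ℝ) → E} (hc : Continuous f)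
    (hf : SubgaussianGrowth f) : ContDiff ℂ ∞ (kernelIntegral f) := by
  rw [contDiff_infty]
  intro k
  induction k generalizing f with
  | zero =>
    rw [Nat.cast_zero, contDiff_zero, continuous_iff_continuousAt]
    exact fun z => (hasFDerivAt_kernelIntegral hc hf z).continuousAt
  | succ k ih =>
    rw [Nat.cast_succ, contDiff_succ_iff_hasFDerivAt]
    refine ⟨_, ?_, hasFDerivAt_kernelIntegral hc hf⟩
    refine ContDiff.sum fun i _ => ?_
    exact (ContinuousLinearMap.smulRightL ℂ (Fin m → ℂ) E (ContinuousLinearMap.proj i)).contDiff.comp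
      ((ih (by fun_prop) (hf.coord_smul i)).const_smul (2 : ℂ))

theorem hasFDerivAt_kernel_real (z : Fin m → ℂ) (x : Fin m → ℝ) :
    HasFDerivAt (kernel z) (kernel z x • ∑ i, (2 * z i - 2 * (x i : ℂ)) •
      Complex.ofRealCLM.comp (ContinuousLinearMap.proj i : (Fin m → ℝ) →L[ℝ] ℝ)) x := by
  let Q : Fin m → (Fin m → ℝ) →L[ℝ] ℂ := fun i =>
    Complex.ofRealCLM.comp (ContinuousLinearMap.proj i)
  have hQ : ∀ i, HasFDerivAt (fun x : Fin m → ℝ => (x i : ℂ)) (Q i) x := fun i => (Q i).hasFDerivAt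
  have h1 : HasFDerivAt (fun x : Fin m → ℝ => ∑ i, z i * (x i : ℂ)) (∑ i, z i • Q i) x :=
    HasFDerivAt.fun_sum fun i _ => (hQ i).const_mul (z i)
  have h2 : HasFDerivAt (fun x : Fin m → ℝ => ∑ i, (x i : ℂ) ^ 2)
      (∑ i, (2 * (x i : ℂ)) • Q i) x := by
    refine HasFDerivAt.fun_sum fun i _ => ?_
    simpa using (hQ i).pow 2
  refine ((h1.const_mul 2).sub h2).cexp.congr_fderiv ?_
  rw [Finset.smul_sum, ← Finset.sum_sub_distrib]
  simp only [smul_smul, ← sub_smul]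
  rfl

theorem fderiv_kernel_single (z : Fin m → ℂ) (x : Fin m → ℝ) (i : Fin m) :
    fderiv ℝ (kernel z) x (Pi.single i 1) = kernel z x * (2 * z i - 2 * (x i : ℂ)) := by
  rw [(hasFDerivAt_kernel_real z x).fderiv, smul_apply,
    sum_apply, Finset.sum_eq_single i]
  · simp
  · intro j _ hj
    simp [hj]
  · simp

/-- Integration by parts in the even variables. -/
theorem kernelIntegral_fderiv [CompleteSpace E] {f : (Fin m → ℝ) → E}
    (hd : Differentiable ℝ f) (hf : SubgaussianGrowth f) (i : Fin m)
    (hc' : Continuous fun x => fderiv ℝ f x (Pi.single i 1))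
    (hf' : SubgaussianGrowth fun x => fderiv ℝ f x (Pi.single i 1)) (z : Fin m → ℂ) :
    kernelIntegral (fun x => fderiv ℝ f x (Pi.single i 1)) z =
      (2 : ℂ) • kernelIntegral (fun x => (x i : ℂ) • f x) z - (2 * z i) • kernelIntegral f z := by
  have hc := hd.continuous
  have hi1 : Integrable fun x => (2 * z i) • (kernel z x • f x) :=
    (integrable_kernel_smul hc hf z).smul (2 * z i)
  have hi2 : Integrable fun x => (2 : ℂ) • (kernel z x • ((x i : ℂ) • f x)) :=
    (integrable_kernel_smul (by fun_prop) (hf.coord_smul i) z).smul (2 : ℂ)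
  have he : ∀ x, fderiv ℝ (kernel z) x (Pi.single i 1) • f x =
      (2 * z i) • (kernel z x • f x) - (2 : ℂ) • (kernel z x • ((x i : ℂ) • f x)) := by
    intro x
    rw [fderiv_kernel_single]
    module
  have h := integral_smul_fderiv_eq_neg_fderiv_smul_of_integrable (𝕜 := ℂ) (μ := volume)
    (f := kernel z) (g := f) (v := Pi.single i (1 : ℝ))
    ((hi1.sub hi2).congr (Filter.Eventually.of_forall fun x => (he x).symm))
    (integrable_kernel_smul hc' hf' z) (integrable_kernel_smul hc hf z)
    (fun x _ => (hasFDerivAt_kernel_real z x).differentiableAt) (fun x _ => hd x)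
  rw [kernelIntegral, h]
  simp only [he]
  rw [integral_sub hi1 hi2, integral_smul, integral_smul, neg_sub]
  rfl

end Gaussian

section Transform

variable {m n : ℕ}

/-! ### Polynomials times the Gaussian -/

variable (m n) in
/-- The space of all polynomials times the Gaussian `exp(-|x|²)`, with coefficients in the
Grassmann algebra. -/
noncomputable def polyGaussian : Submodule ℂ (Smooth ℝ m n) :=
  generated (fun i : Fin m => mulOp (Sum.inl i))
    {f | ∃ a : Lam n, ∀ x, f.1 x = Complex.exp (-∑ i, (x i : ℂ) ^ 2) • a}

theorem gaussian_mem {f : Smooth ℝ m n} (a : Lam n)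
    (hf : ∀ x, f.1 x = Complex.exp (-∑ i, (x i : ℂ) ^ 2) • a) : f ∈ polyGaussian m n := by
  rw [polyGaussian, generated, Submodule.mem_sInf]
  exact fun W hW => hW.1 ⟨a, hf⟩

theorem mulOp_inl_mem (i : Fin m) {f : Smooth ℝ m n} (hf : f ∈ polyGaussian m n) :
    mulOp (Sum.inl i) f ∈ polyGaussian m n :=
  generated_invariant _ _ i hf

/-- Induction over `polyGaussian`. -/
theorem polyGaussian_le {W : Submodule ℂ (Smooth ℝ m n)}
    (gauss : ∀ (f : Smooth ℝ m n) (a : Lam n),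
      (∀ x, f.1 x = Complex.exp (-∑ i, (x i : ℂ) ^ 2) • a) → f ∈ W)
    (mul : ∀ i, ∀ f ∈ polyGaussian m n, f ∈ W → mulOp (Sum.inl i) f ∈ W) :
    polyGaussian m n ≤ W := by
  have h : polyGaussian m n ≤ polyGaussian m n ⊓ W := by
    refine sInf_le ⟨?_, ?_⟩
    · rintro f ⟨a, ha⟩
      exact ⟨gaussian_mem a ha, gauss f a ha⟩
    · exact fun i f hf => ⟨mulOp_inl_mem i hf.1, mul i f hf.1 hf.2⟩
  exact fun f hf => (h hf).2

theorem mulOp_mem (i : Idx m n) {f : Smooth ℝ m n} (hf : f ∈ polyGaussian m n) :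
    mulOp i f ∈ polyGaussian m n := by
  rcases i with i | j
  · exact mulOp_inl_mem i hf
  · have h : polyGaussian m n ≤ (polyGaussian m n).comap (mulOp (Sum.inr j)) := by
      refine polyGaussian_le (fun f a ha => ?_) fun i f _ hf => ?_
      · refine gaussian_mem (gen (oddVec j) * a) fun x => ?_
        rw [mulOp_inr_apply, ha, mul_smul_comm]
      · rw [Submodule.mem_comap, mulOp_comm]
        exact Submodule.smul_mem _ _ (mulOp_inl_mem i hf)
    exact h hf

theorem hasFDerivAt_gaussian (x : Fin m → ℝ) :
    HasFDerivAt (fun x : Fin m → ℝ => Complex.exp (-∑ i, (x i : ℂ) ^ 2))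
      (Complex.exp (-∑ i, (x i : ℂ) ^ 2) • ∑ i, (-2 * (x i : ℂ)) •
        Complex.ofRealCLM.comp (ContinuousLinearMap.proj i : (Fin m → ℝ) →L[ℝ] ℝ)) x := by
  have h := hasFDerivAt_kernel_real (0 : Fin m → ℂ) x
  have hk : kernel (0 : Fin m → ℂ) = fun x => Complex.exp (-∑ i, (x i : ℂ) ^ 2) := by
    funext y
    simp [kernel]
  rw [hk] at h
  simpa only [Pi.zero_apply, mul_zero, zero_sub, ← neg_mul] using h

theorem evenDeriv_gaussian (i : Fin m) {f : Smooth ℝ m n} (a : Lam n)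
    (hf : ∀ x, f.1 x = Complex.exp (-∑ i, (x i : ℂ) ^ 2) • a) :
    evenDeriv i f = (-2 : ℂ) • mulOp (Sum.inl i) f := by
  refine smooth_ext fun x => ?_
  have h1 := (hasFDerivAt_gaussian x).smul_const a
  have h2 : f.1 = fun x => Complex.exp (-∑ i, (x i : ℂ) ^ 2) • a := funext hf
  have h3 : ((-2 : ℂ) • mulOp (Sum.inl i) f : Smooth ℝ m n).1 x =
      (-2 : ℂ) • ((x i : ℂ) • f.1 x) := by
    rw [Submodule.coe_smul, Pi.smul_apply, mulOp_inl_apply]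
    rfl
  have h4 : ∑ j, ((-2 * (x j : ℂ)) • Complex.ofRealCLM.comp
      (ContinuousLinearMap.proj j : (Fin m → ℝ) →L[ℝ] ℝ)) (Pi.single i 1) = -2 * (x i : ℂ) := by
    rw [Finset.sum_eq_single i]
    · simp
    · intro j _ hj
      simp [hj]
    · simp
  rw [h3, evenDeriv_apply, h2, h1.fderiv, ContinuousLinearMap.smulRight_apply, smul_apply,
    sum_apply, h4, smul_eq_mul]
  module

theorem partialLow_mem (i : Idx m n) {f : Smooth ℝ m n} (hf : f ∈ polyGaussian m n) :
    partialLow i f ∈ polyGaussian m n := by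
  have h : polyGaussian m n ≤ (polyGaussian m n).comap (partialLow i) := by
    refine polyGaussian_le (fun f a ha => ?_) fun k f hf hf' => ?_
    · rcases i with i | j
      · rw [Submodule.mem_comap, partialLow_inl, evenDeriv_gaussian i a ha]
        exact Submodule.smul_mem _ _ (mulOp_inl_mem i (gaussian_mem a ha))
      · refine gaussian_mem (oddLow j a) fun x => ?_
        rw [partialLow_inr_apply, ha, map_smul]
    · rw [Submodule.mem_comap, partialLow_mulOp]
      exact add_mem (Submodule.smul_mem _ _ hf)
        (Submodule.smul_mem _ _ (mulOp_inl_mem k hf'))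
  exact h hf

theorem genOp_mem (a b : DIdx m n) {f : Smooth ℝ m n} (hf : f ∈ polyGaussian m n) :
    genOp a b f ∈ polyGaussian m n := by
  have hc : ∀ i j : Idx m n, ∀ c d : ℂ,
      c • f - d • mulOp j (partialLow i f) ∈ polyGaussian m n := fun i j c d =>
    sub_mem (Submodule.smul_mem _ _ hf)
      (Submodule.smul_mem _ _ (mulOp_mem _ (partialLow_mem _ hf)))
  rcases a with i | i <;> rcases b with j | j
  · exact Submodule.smul_mem _ _ (partialLow_mem _ (partialLow_mem _ hf))
  · exact hc _ _ _ _
  · exact Submodule.smul_mem _ _ (hc _ _ _ _)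
  · exact Submodule.smul_mem _ _ (mulOp_mem _ (mulOp_mem _ hf))

theorem metaplectic_apply {𝕂 : Type} [RCLike 𝕂] [NormedAlgebra 𝕂 ℂ]
    [NormedSpace 𝕂 (Lam n)] [IsScalarTower 𝕂 ℂ (Lam n)]
    (X : Matrix (DIdx m n) (DIdx m n) ℂ) (f : Smooth 𝕂 m n) :
    metaplectic X f = (1 / 2 : ℂ) • ∑ a, ∑ b, (X * (Omega ℂ m n)⁻¹) a b • genOp a b f := by
  simp [metaplectic]

theorem metaplectic_mem (X : Matrix (DIdx m n) (DIdx m n) ℂ) {f : Smooth ℝ m n}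
    (hf : f ∈ polyGaussian m n) : metaplectic X f ∈ polyGaussian m n := by
  rw [metaplectic_apply]
  exact Submodule.smul_mem _ _ (Submodule.sum_mem _ fun a _ => Submodule.sum_mem _ fun b _ =>
    Submodule.smul_mem _ _ (genOp_mem a b hf))

theorem growth_of_mem {f : Smooth ℝ m n} (hf : f ∈ polyGaussian m n) :
    SubgaussianGrowth f.1 := by
  let W : Submodule ℂ (Smooth ℝ m n) :=
    { carrier := {f | SubgaussianGrowth f.1}
      add_mem' := fun hf hg => SubgaussianGrowth.add hf hg
      zero_mem' := fun t _ => ⟨0, le_rfl, fun x => by simp⟩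
      smul_mem' := fun c f hf => SubgaussianGrowth.const_smul hf c }
  have h : polyGaussian m n ≤ W := by
    refine polyGaussian_le (fun f a ha t ht => ⟨‖a‖, norm_nonneg _, fun x => ?_⟩)
      fun i f _ hf => ?_
    · have h1 : ‖Complex.exp (-∑ i, (x i : ℂ) ^ 2)‖ ≤ Real.exp (t * ∑ i, x i ^ 2) := by
        have h2 : -∑ i, (x i : ℂ) ^ 2 = ((-∑ i, x i ^ 2 : ℝ) : ℂ) := by push_cast; rfl
        rw [Complex.norm_exp, h2, Complex.ofReal_re]
        have h3 : 0 ≤ ∑ i, x i ^ 2 := Finset.sum_nonneg fun i _ => sq_nonneg _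
        exact Real.exp_le_exp.2 ((neg_nonpos.2 h3).trans (mul_nonneg ht.le h3))
      rw [ha, norm_smul, mul_comm]
      exact mul_le_mul_of_nonneg_left h1 (norm_nonneg _)
    · have h1 : (mulOp (Sum.inl i) f).1 = fun x => (x i : ℂ) • f.1 x :=
        funext fun x => mulOp_inl_apply i f x
      change SubgaussianGrowth (mulOp (Sum.inl i) f).1
      rw [h1]
      exact SubgaussianGrowth.coord_smul hf i
  exact h hf

theorem expNegRsq_apply (x : Fin m → ℝ) : (expNegRsq m n).1 x =
    Complex.exp (-∑ i, (x i : ℂ) ^ 2) • gexp ((-1 : ℂ) • oddRsq n) := by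
  change gexp (-Rsq x) = _
  rw [Rsq_eq, neg_add, ← neg_smul, gexp_add_scalar, ← neg_one_smul ℂ (oddRsq n)]
  · rfl
  · rw [← neg_one_smul ℂ, body_smul_oddRsq]

theorem expNegRsq_mem : expNegRsq m n ∈ polyGaussian m n := gaussian_mem _ expNegRsq_apply

theorem schrodingerModule_le (K : Type*) [Field K] [Algebra K ℂ] :
    schrodingerModule K m n ≤ polyGaussian m n := by
  refine sup_le (sInf_le ⟨?_, ?_⟩) (sInf_le ⟨?_, ?_⟩)
  · rintro _ rfl
    exact expNegRsq_mem
  · exact fun X f hf => metaplectic_mem _ hf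
  · rintro _ ⟨i, -, rfl⟩
    exact mulOp_mem i expNegRsq_mem
  · exact fun X f hf => metaplectic_mem _ hf

/-! ### The Segal–Bargmann transform as a product of its even and odd parts -/

theorem sbIntegrand_eq (f : (Fin m → ℝ) → Lam n) (z : Fin m → ℂ) (x : Fin m → ℝ) :
    sbIntegrand f z x = oddKernel n * embX (kernel z x • f x) := by
  have h1 : gexp ((2 : ℂ) • traceProd (n := n) z x) =
      Complex.exp (2 * ∑ i, z i * x i) • gexp ((2 : ℂ) • pairing (n := n) zVec xVec) := by
    rw [traceProd_eq, smul_add, smul_smul, gexp_add_scalar _ (body_smul_pairing _ _ _)]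
  have h2 : (gexp (-Rsq x) : Lam n) =
      Complex.exp (-∑ i, (x i : ℂ) ^ 2) • gexp ((-1 : ℂ) • oddRsq n) := expNegRsq_apply x
  rw [sbIntegrand, h1, h2, kernel, sub_eq_add_neg, Complex.exp_add, oddKernel]
  simp only [map_smul, mul_smul_comm, smul_mul_assoc, smul_smul]
  rw [mul_comm (Complex.exp _)]

theorem integrable_kernel_of_mem {f : Smooth ℝ m n} (hf : f ∈ polyGaussian m n)
    (z : Fin m → ℂ) : Integrable fun x => kernel z x • f.1 x :=
  integrable_kernel_smul (smooth_contDiff f).continuous (growth_of_mem hf) z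

/-- The integrand is integrable for all polynomials times the Gaussian. -/
theorem integrable_sbIntegrand {f : Smooth ℝ m n} (hf : f ∈ polyGaussian m n) (z : Fin m → ℂ) :
    Integrable (sbIntegrand f.1 z) := by
  have h : sbIntegrand f.1 z = fun x => oddKernel n * embX (kernel z x • f.1 x) :=
    funext fun x => sbIntegrand_eq f.1 z x
  rw [h]
  exact (LinearMap.toContinuousLinearMap
    (LinearMap.mulLeft ℂ (oddKernel n) ∘ₗ embX.toLinearMap)).integrable_comp
      (integrable_kernel_of_mem hf z)

/-- The transform is a Gaussian integral in the even variables followed by a constant linear map in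
the odd ones. -/
theorem segalBargmann_eq {f : Smooth ℝ m n} (hf : f ∈ polyGaussian m n) (z : Fin m → ℂ) :
    segalBargmann f.1 z = ((omega m n)⁻¹ * Complex.exp (-(1 / 2) * ∑ i, z i ^ 2)) •
      oddTransform (kernelIntegral f.1 z) := by
  have h1 : gexp (-((1 / 2 : ℂ) • Rsq z)) =
      Complex.exp (-(1 / 2) * ∑ i, z i ^ 2) • gexp ((-(1 / 2) : ℂ) • oddRsq n) := by
    rw [Rsq_eq, smul_add, neg_add, smul_smul, ← neg_smul, ← neg_smul, ← neg_mul,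
      gexp_add_scalar _ (body_smul_oddRsq _)]
    rfl
  have h2 : ∫ x : Fin m → ℝ, berezin xForm (sbIntegrand f.1 z x) =
      berezin xForm (oddKernel n * embX (kernelIntegral f.1 z)) := by
    simp only [sbIntegrand_eq]
    exact (LinearMap.toContinuousLinearMap
      (berezin xForm ∘ₗ LinearMap.mulLeft ℂ (oddKernel n) ∘ₗ embX.toLinearMap)).integral_comp_comm
        (integrable_kernel_of_mem hf z)
  change (omega m n)⁻¹ • (_ * dropX (∫ x : Fin m → ℝ, berezin xForm (sbIntegrand f.1 z x))) = _
  rw [h2, h1, ← oddIntegral_apply, smul_mul_assoc, ← oddTransform_apply, smul_smul]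

theorem omega_eq (m n : ℕ) : omega m n =
    (∫ x : Fin m → ℝ, Complex.exp (-2 * ∑ i, (x i : ℂ) ^ 2)) *
      body (berezin oddForm (gexp (-((2 : ℂ) • oddRsq n))) : Lam n) := by
  have h : ∀ x : Fin m → ℝ, berezin oddForm (gexp (-((2 : ℂ) • Rsq x)) : Lam n) =
      Complex.exp (-2 * ∑ i, (x i : ℂ) ^ 2) •
        berezin oddForm (gexp (-((2 : ℂ) • oddRsq n)) : Lam n) := by
    intro x
    rw [Rsq_eq, smul_add, neg_add, smul_smul, ← neg_smul, ← neg_mul, gexp_add_scalar, map_smul]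
    · rfl
    · rw [← neg_smul, body_smul_oddRsq]
  rw [omega]
  simp only [h]
  rw [integral_smul_const, map_smul, smul_eq_mul]

theorem integral_gaussian_ne_zero :
    ∫ x : Fin m → ℝ, Complex.exp (-2 * ∑ i, (x i : ℂ) ^ 2) ≠ 0 := by
  have h := GaussianFourier.integral_cexp_neg_mul_sum_add (ι := Fin m) (b := 2) (by norm_num) 0
  simp only [Pi.zero_apply, zero_mul, Finset.sum_const_zero, add_zero] at h
  rw [h]
  refine mul_ne_zero ?_ (Complex.exp_ne_zero _)
  rw [Complex.cpow_def_of_ne_zero (by simp [Real.pi_ne_zero])]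
  exact Complex.exp_ne_zero _

theorem omega_ne_zero (m n : ℕ) : omega m n ≠ 0 := by
  rw [omega_eq]
  exact mul_ne_zero integral_gaussian_ne_zero body_berezin_gexp_ne_zero

/-! ### Transforms of coordinates and derivatives -/

/-- `F` is the Segal–Bargmann transform of `f`, and `f` is a polynomial times the Gaussian. -/
def IsTransform (f : Smooth ℝ m n) (F : Smooth ℂ m n) : Prop :=
  f ∈ polyGaussian m n ∧ ∀ z, F.1 z = segalBargmann f.1 z

theorem contDiff_segalBargmann {f : Smooth ℝ m n} (hf : f ∈ polyGaussian m n) :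
    ContDiff ℂ ∞ (segalBargmann f.1) := by
  have h : segalBargmann f.1 = fun z => ((omega m n)⁻¹ *
      Complex.exp (-(1 / 2) * ∑ i, z i ^ 2)) • oddTransform (kernelIntegral f.1 z) :=
    funext fun z => segalBargmann_eq hf z
  rw [h]
  have h1 := contDiff_linear (𝕂 := ℂ) (m := m) (oddTransform (n := n))
    (contDiff_kernelIntegral (smooth_contDiff f).continuous (growth_of_mem hf))
  have h2 : ContDiff ℂ ∞ fun z : Fin m → ℂ => (omega m n)⁻¹ *
      Complex.exp (-(1 / 2) * ∑ i, z i ^ 2) := by fun_prop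
  exact h2.smul h1

theorem exists_isTransform {f : Smooth ℝ m n} (hf : f ∈ polyGaussian m n) :
    ∃ F, IsTransform f F :=
  ⟨⟨segalBargmann f.1, contDiff_segalBargmann hf⟩, hf, fun _ => rfl⟩

theorem IsTransform.unique {f : Smooth ℝ m n} {F G : Smooth ℂ m n} (hF : IsTransform f F)
    (hG : IsTransform f G) : F = G :=
  smooth_ext fun z => (hF.2 z).trans (hG.2 z).symm

theorem kernelIntegral_add {f g : Smooth ℝ m n} (hf : f ∈ polyGaussian m n)
    (hg : g ∈ polyGaussian m n) (z : Fin m → ℂ) :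
    kernelIntegral (f + g).1 z = kernelIntegral f.1 z + kernelIntegral g.1 z := by
  rw [kernelIntegral, kernelIntegral, kernelIntegral,
    ← integral_add (integrable_kernel_of_mem hf z) (integrable_kernel_of_mem hg z)]
  congr 1
  funext x
  exact smul_add _ _ _

theorem kernelIntegral_smul (c : ℂ) (f : Smooth ℝ m n) (z : Fin m → ℂ) :
    kernelIntegral (c • f).1 z = c • kernelIntegral f.1 z := by
  rw [kernelIntegral, kernelIntegral, ← integral_smul]
  congr 1
  funext x
  exact smul_comm (kernel z x) c (f.1 x)

theorem IsTransform.add {f g : Smooth ℝ m n} {F G : Smooth ℂ m n} (hF : IsTransform f F)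
    (hG : IsTransform g G) : IsTransform (f + g) (F + G) := by
  refine ⟨add_mem hF.1 hG.1, fun z => ?_⟩
  rw [segalBargmann_eq (add_mem hF.1 hG.1), kernelIntegral_add hF.1 hG.1, map_add, smul_add,
    ← segalBargmann_eq hF.1, ← segalBargmann_eq hG.1, ← hF.2, ← hG.2]
  rfl

theorem IsTransform.smul {f : Smooth ℝ m n} {F : Smooth ℂ m n} (c : ℂ) (hF : IsTransform f F) :
    IsTransform (c • f) (c • F) := by
  refine ⟨Submodule.smul_mem _ _ hF.1, fun z => ?_⟩
  rw [segalBargmann_eq (Submodule.smul_mem _ _ hF.1), kernelIntegral_smul, map_smul, smul_comm,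
    ← segalBargmann_eq hF.1, ← hF.2]
  rfl

theorem IsTransform.sub {f g : Smooth ℝ m n} {F G : Smooth ℂ m n} (hF : IsTransform f F)
    (hG : IsTransform g G) : IsTransform (f - g) (F - G) := by
  have h := hF.add (hG.smul (-1))
  rwa [neg_one_smul ℂ g, neg_one_smul ℂ G, ← sub_eq_add_neg, ← sub_eq_add_neg] at h

theorem IsTransform.sum {ι : Type*} (s : Finset ι) {f : ι → Smooth ℝ m n} {F : ι → Smooth ℂ m n}
    (h : ∀ i ∈ s, IsTransform (f i) (F i)) : IsTransform (∑ i ∈ s, f i) (∑ i ∈ s, F i) := by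
  classical
  induction s using Finset.induction_on with
  | empty =>
    obtain ⟨G, hG⟩ := exists_isTransform (zero_mem (polyGaussian m n))
    simpa using hG.smul 0
  | insert i s hi ih =>
    rw [Finset.sum_insert hi, Finset.sum_insert hi]
    exact (h i (Finset.mem_insert_self _ _)).add
      (ih fun j hj => h j (Finset.mem_insert_of_mem hj))

end Transform

section Intertwining

variable {m n : ℕ}

theorem kernelIntegral_linear (L : Module.End ℂ (Lam n)) {f : Smooth ℝ m n}
    (hf : f ∈ polyGaussian m n) (z : Fin m → ℂ) :
    kernelIntegral (fun x => L (f.1 x)) z = L (kernelIntegral f.1 z) := by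
  rw [kernelIntegral, kernelIntegral]
  have h := (LinearMap.toContinuousLinearMap L).integral_comp_comm (integrable_kernel_of_mem hf z)
  refine Eq.trans ?_ h
  congr 1
  funext x
  exact (map_smul L _ _).symm

theorem kernelIntegral_mulOp_inl (i : Fin m) (f : Smooth ℝ m n) (z : Fin m → ℂ) :
    kernelIntegral (mulOp (Sum.inl i) f).1 z = kernelIntegral (fun x => (x i : ℂ) • f.1 x) z := by
  congr 1
  exact funext fun x => mulOp_inl_apply i f x

/-- The derivative in `z` hits the factor `exp(-½ z²)` and, under the integral, the kernel. -/
theorem evenDeriv_transform {f : Smooth ℝ m n} {F : Smooth ℂ m n} (h : IsTransform f F)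
    (i : Fin m) (z : Fin m → ℂ) :
    (evenDeriv i F).1 z =
      (2 : ℂ) • segalBargmann (mulOp (Sum.inl i) f).1 z - z i • F.1 z := by
  have hF : F.1 = fun z => ((omega m n)⁻¹ * Complex.exp (-(1 / 2) * ∑ i, z i ^ 2)) •
      oddTransform (kernelIntegral f.1 z) :=
    funext fun z => (h.2 z).trans (segalBargmann_eq h.1 z)
  have hcont := (smooth_contDiff f).continuous
  have hg := growth_of_mem h.1
  have h1 : HasFDerivAt (fun z : Fin m → ℂ => ∑ i, z i ^ 2) (∑ i, (2 * z i) •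
      (ContinuousLinearMap.proj i : (Fin m → ℂ) →L[ℂ] ℂ)) z := by
    refine HasFDerivAt.fun_sum fun i _ => ?_
    simpa using (ContinuousLinearMap.proj (R := ℂ) (φ := fun _ : Fin m => ℂ) i).hasFDerivAt.pow 2
  have h2 := (((h1.const_mul (-(1 / 2))).cexp).const_mul (omega m n)⁻¹).smul
    ((LinearMap.toContinuousLinearMap (oddTransform (n := n))).hasFDerivAt.comp z
      (hasFDerivAt_kernelIntegral hcont hg z))
  have h3 : (∑ k, (2 * z k) • (ContinuousLinearMap.proj k : (Fin m → ℂ) →L[ℂ] ℂ))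
      (Pi.single i 1) = 2 * z i := by
    rw [sum_apply, Finset.sum_eq_single i]
    · simp
    · intro j _ hj
      simp [hj]
    · simp
  have h4 : (∑ k, (ContinuousLinearMap.proj k : (Fin m → ℂ) →L[ℂ] ℂ).smulRight
      ((2 : ℂ) • kernelIntegral (fun x => (x k : ℂ) • f.1 x) z)) (Pi.single i 1) =
      (2 : ℂ) • kernelIntegral (fun x => (x i : ℂ) • f.1 x) z := by
    rw [← (hasFDerivAt_kernelIntegral hcont hg z).fderiv, fderiv_kernelIntegral hcont hg]
  have h5 := (congrArg (fun G => fderiv ℂ G z) hF).trans h2.fderiv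
  change fderiv ℂ F.1 z = _ at h5
  rw [evenDeriv_apply, h5, segalBargmann_eq (mulOp_inl_mem i h.1),
    kernelIntegral_mulOp_inl, add_apply, smul_apply, ContinuousLinearMap.comp_apply, h4,
    ContinuousLinearMap.smulRight_apply, smul_apply, smul_apply, smul_apply, h3, h.2,
    segalBargmann_eq h.1]
  change _ • oddTransform ((2 : ℂ) • kernelIntegral (fun x => (x i : ℂ) • f.1 x) z) +
    _ • oddTransform (kernelIntegral f.1 z) = _
  rw [map_smul]
  simp only [smul_eq_mul]
  module

/-- Under the Segal–Bargmann transform, `ℓ_i` corresponds to `½ (ℓ_i + ∂_i)`. -/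
theorem IsTransform.mulOp {f : Smooth ℝ m n} {F : Smooth ℂ m n} (h : IsTransform f F)
    (i : Idx m n) :
    IsTransform (mulOp i f) ((1 / 2 : ℂ) • (mulOp i F + partialLow i F)) := by
  refine ⟨mulOp_mem i h.1, fun z => ?_⟩
  rcases i with i | j
  · have h1 : ((1 / 2 : ℂ) • (SuperSB.mulOp (Sum.inl i) F + partialLow (Sum.inl i) F) :
        Smooth ℂ m n).1 z = (1 / 2 : ℂ) • (z i • F.1 z + (evenDeriv i F).1 z) := by
      rw [partialLow_inl]
      exact congrArg (fun a => (1 / 2 : ℂ) • (a + (evenDeriv i F).1 z)) (mulOp_inl_apply i F z)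
    rw [h1, evenDeriv_transform h]
    module
  · have h1 : ((1 / 2 : ℂ) • (SuperSB.mulOp (Sum.inr j) F + partialLow (Sum.inr j) F) :
        Smooth ℂ m n).1 z = (1 / 2 : ℂ) • (gen (oddVec j) * F.1 z + oddLow j (F.1 z)) := by
      rw [← partialLow_inr_apply]
      rfl
    have h2 : kernelIntegral (SuperSB.mulOp (Sum.inr j) f).1 z =
        gen (oddVec j) * kernelIntegral f.1 z :=
      kernelIntegral_linear (LinearMap.mulLeft ℂ (gen (oddVec j))) h.1 z
    rw [h1, segalBargmann_eq (mulOp_mem _ h.1), h2, oddTransform_gen_mul, h.2,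
      segalBargmann_eq h.1, map_smul, mul_smul_comm]
    module

/-- Under the Segal–Bargmann transform, `∂_i` corresponds to `∂_i - ℓ_i`. -/
theorem IsTransform.partialLow {f : Smooth ℝ m n} {F : Smooth ℂ m n} (h : IsTransform f F)
    (i : Idx m n) : IsTransform (partialLow i f) (partialLow i F - SuperSB.mulOp i F) := by
  refine ⟨partialLow_mem i h.1, fun z => ?_⟩
  rcases i with i | j
  · have h1 : (SuperSB.partialLow (Sum.inl i) F - SuperSB.mulOp (Sum.inl i) F :
        Smooth ℂ m n).1 z = (evenDeriv i F).1 z - z i • F.1 z := by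
      rw [partialLow_inl]
      exact congrArg (fun a => (evenDeriv i F).1 z - a) (mulOp_inl_apply i F z)
    have h0 := partialLow_mem (Sum.inl i) h.1
    rw [partialLow_inl] at h0
    have hgrow := growth_of_mem h0
    have hcont := (smooth_contDiff (evenDeriv i f)).continuous
    have h2 := kernelIntegral_fderiv (fun x => smooth_differentiableAt f x) (growth_of_mem h.1) i
      hcont hgrow z
    change kernelIntegral (evenDeriv i f).1 z = _ at h2
    rw [h1, evenDeriv_transform h, partialLow_inl, segalBargmann_eq h0, h2, h.2,
      segalBargmann_eq h.1, segalBargmann_eq (mulOp_inl_mem i h.1), kernelIntegral_mulOp_inl,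
      map_sub, map_smul, map_smul]
    module
  · have h1 : (SuperSB.partialLow (Sum.inr j) F - SuperSB.mulOp (Sum.inr j) F :
        Smooth ℂ m n).1 z = oddLow j (F.1 z) - gen (oddVec j) * F.1 z := by
      rw [← partialLow_inr_apply]
      rfl
    have h3 : (SuperSB.partialLow (Sum.inr j) f).1 = fun x => oddLow j (f.1 x) :=
      funext fun x => partialLow_inr_apply j f x
    have h2 : kernelIntegral (SuperSB.partialLow (Sum.inr j) f).1 z =
        oddLow j (kernelIntegral f.1 z) := by
      rw [h3]
      exact kernelIntegral_linear (oddLow j) h.1 z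
    rw [h1, segalBargmann_eq (partialLow_mem _ h.1), h2, oddTransform_oddLow, h.2,
      segalBargmann_eq h.1, map_smul, mul_smul_comm, smul_sub]

/-! ### The transform of the Gaussian -/

theorem partialLow_expNegRsq (i : Idx m n) :
    partialLow i (expNegRsq m n) = (-2 : ℂ) • mulOp i (expNegRsq m n) := by
  rcases i with i | j
  · rw [partialLow_inl, evenDeriv_gaussian i _ expNegRsq_apply]
  · refine smooth_ext fun x => ?_
    have h1 : ((-2 : ℂ) • mulOp (Sum.inr j) (expNegRsq m n) : Smooth ℝ m n).1 x =
        (-2 : ℂ) • (gen (oddVec j) * (expNegRsq m n).1 x) := rfl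
    have h2 := oddLow_gexp_mul (-1) j (1 : Lam n)
    have h3 : oddLow j (1 : Lam n) = 0 := by simp [oddLow, lowContract_apply]
    rw [mul_one, h3, mul_zero, add_zero] at h2
    rw [h1, partialLow_inr_apply, expNegRsq_apply, map_smul, h2, mul_smul_comm]
    module

theorem body_segalBargmann_expNegRsq : body (segalBargmann (expNegRsq m n).1 0) = 1 := by
  have h : kernelIntegral (expNegRsq m n).1 0 =
      (∫ x : Fin m → ℝ, Complex.exp (-2 * ∑ i, (x i : ℂ) ^ 2)) • gexp ((-1 : ℂ) • oddRsq n) := by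
    rw [kernelIntegral, ← integral_smul_const]
    congr 1
    funext x
    rw [expNegRsq_apply, smul_smul, kernel, ← Complex.exp_add]
    congr 2
    simp only [Pi.zero_apply, zero_mul, Finset.sum_const_zero, mul_zero]
    ring
  have h0 := omega_ne_zero m n
  rw [segalBargmann_eq expNegRsq_mem, h, map_smul, map_smul, map_smul, body_oddTransform,
    smul_eq_mul, smul_eq_mul, ← omega_eq]
  simp [h0]

/-- The transform of the Gaussian is `1`: since `(∂_i + 2 ℓ_i) exp(-R²) = 0`, all derivatives of
the transform vanish, and its value at zero is fixed by the normalization. -/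
theorem isTransform_expNegRsq : IsTransform (expNegRsq m n) (oneFun m n) := by
  obtain ⟨F, hF⟩ := exists_isTransform (expNegRsq_mem (m := m) (n := n))
  have hzero : ∀ i, partialLow i F = 0 := by
    intro i
    have h1 := hF.partialLow i
    rw [partialLow_expNegRsq] at h1
    have h2 := h1.unique ((hF.mulOp i).smul (-2))
    have h3 : (2 : ℂ) • partialLow i F = 0 := by
      have h4 := sub_eq_zero.2 h2
      rw [← h4]
      module
    exact (smul_eq_zero.1 h3).resolve_left two_ne_zero
  have hscalar : ∀ z, F.1 z = algebraMap ℂ (Lam n) (body (F.1 z)) := by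
    intro z
    refine eq_body_of_contract_eq_zero _ fun j => ?_
    rw [contract_oddForm_eq]
    refine Finset.sum_eq_zero fun k _ => ?_
    rw [← partialLow_inr_apply, hzero]
    exact smul_zero _
  have hconst : ∀ z, F.1 z = F.1 0 := by
    intro z
    refine is_const_of_fderiv_eq_zero (𝕜 := ℂ) (fun x => smooth_differentiableAt F x) (fun x => ?_)
      z 0
    ext v
    have hv : v = ∑ i, v i • (Pi.single i 1 : Fin m → ℂ) := by
      funext k
      simp [Pi.single_apply]
    rw [hv, map_sum]
    refine Finset.sum_eq_zero fun i _ => ?_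
    have h1 := hzero (Sum.inl i)
    rw [partialLow_inl] at h1
    rw [map_smul, ← evenDeriv_apply, h1]
    exact smul_zero _
  have hone : F = oneFun m n := by
    refine smooth_ext fun z => ?_
    rw [hconst, hscalar, hF.2, body_segalBargmann_expNegRsq, map_one]
    rfl
  rwa [hone] at hF

theorem isTransform_mulOp_expNegRsq (i : Idx m n) :
    IsTransform (mulOp i (expNegRsq m n)) ((1 / 2 : ℂ) • mulOp i (oneFun m n)) := by
  have h := (isTransform_expNegRsq (m := m) (n := n)).mulOp i
  have h0 : partialLow i (oneFun m n) = 0 := by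
    refine smooth_ext fun z => ?_
    rcases i with i | j
    · rw [partialLow_inl, evenDeriv_apply]
      change fderiv ℂ (fun _ : Fin m → ℂ => (1 : Lam n)) z _ = 0
      simp
    · rw [partialLow_inr_apply]
      change oddLow j (1 : Lam n) = 0
      simp [oddLow, lowContract_apply]
  rwa [h0, add_zero] at h

end Intertwining

/-! ### The Cayley transform as a conjugation -/

section Cayley

variable {m n : ℕ}

theorem beta_swap (i j : Idx m n) :
    beta ℂ m n j i = (-1 : ℂ) ^ (par i * par j) * beta ℂ m n i j := by
  rcases i with i | i <;> rcases j with j | j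
  · simp [beta_eq_fromBlocks, par, Matrix.one_apply, eq_comm]
  · simp [beta_eq_fromBlocks, par]
  · simp [beta_eq_fromBlocks, par]
  · simp [beta_eq_fromBlocks, par, oddBeta_swap i j]

theorem beta_inv_eq_transpose : (beta ℂ m n)⁻¹ = (beta ℂ m n).transpose := by
  rw [beta_inv, beta_eq_fromBlocks, Matrix.fromBlocks_transpose]
  simp

theorem beta_mul_transpose : beta ℂ m n * (beta ℂ m n).transpose = 1 := by
  rw [← beta_inv_eq_transpose, beta_inv, beta_eq_fromBlocks, Matrix.fromBlocks_multiply]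
  simp [oddBeta_mul_transpose]

theorem beta_transpose_mul : (beta ℂ m n).transpose * beta ℂ m n = 1 :=
  mul_eq_one_comm.1 beta_mul_transpose

theorem U_apply (a b p q : DIdx m n) : (U a b : Matrix _ _ ℂ) p q =
    (if a = p then Omega ℂ m n b q else 0) +
      (if b = p then (-1) ^ (dpar a * dpar b) * Omega ℂ m n a q else 0) := by
  simp only [U, Matrix.sum_apply, Matrix.add_apply, Matrix.single_apply, Finset.sum_add_distrib]
  congr 1
  · by_cases h : a = p <;> simp [h]
  · by_cases h : b = p <;> simp [h]

theorem beta_transpose_swap (i j : Idx m n) :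
    (-1 : ℂ) ^ (par i * par j) * (beta ℂ m n).transpose i j = (beta ℂ m n).transpose j i := by
  rw [Matrix.transpose_apply, Matrix.transpose_apply, beta_swap j i, mul_comm (par j)]

/-- `∑ β^{ij} U_{a(i) a(j)}`, for one of the two copies `a` of the index set. -/
theorem sum_beta_U (a : Idx m n → DIdx m n) (ha : Function.Injective a)
    (hpar : ∀ i, dpar (a i) = par i) (p : Idx m n) (q : DIdx m n) :
    (∑ i, ∑ j, (beta ℂ m n)⁻¹ i j • (U (a i) (a j) : Matrix _ _ ℂ)) (a p) q =
      2 * ∑ j, (beta ℂ m n).transpose p j * Omega ℂ m n (a j) q := by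
  simp only [Matrix.sum_apply, Matrix.smul_apply, U_apply, smul_eq_mul, mul_add,
    Finset.sum_add_distrib, hpar, ha.eq_iff, mul_ite, mul_zero, beta_inv_eq_transpose, two_mul]
  congr 1
  · rw [Finset.sum_comm]
    simp
  · simp only [Finset.sum_ite_eq', Finset.mem_univ, if_true]
    refine Finset.sum_congr rfl fun i _ => ?_
    rw [← beta_transpose_swap i p]
    ring

theorem sum_beta_U_eq_zero (a : Idx m n → DIdx m n) (p q : DIdx m n) (hp : ∀ i, a i ≠ p) :
    (∑ i, ∑ j, (beta ℂ m n)⁻¹ i j • (U (a i) (a j) : Matrix _ _ ℂ)) p q = 0 := by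
  simp [Matrix.sum_apply, U_apply, hp]

theorem eMinus_eq : eMinus m n = Matrix.fromBlocks 0 0 (-1) 0 := by
  have hmul : ∀ p q : Idx m n, ∑ j, (beta ℂ m n).transpose p j * beta ℂ m n j q =
      (1 : Matrix (Idx m n) (Idx m n) ℂ) p q := by
    intro p q
    rw [← beta_transpose_mul, Matrix.mul_apply]
  ext p q
  rw [eMinus, Matrix.smul_apply]
  rcases p with p | p
  · rw [sum_beta_U_eq_zero _ _ _ (by simp)]
    rcases q with q | q <;> simp
  · rw [sum_beta_U Sum.inr Sum.inr_injective (fun _ => rfl)]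
    rcases q with q | q
    · simp only [Omega, Matrix.fromBlocks_apply₂₁, hmul, Matrix.neg_apply, smul_eq_mul]
      ring
    · simp [Omega]

theorem ePlus_eq : ePlus m n = Matrix.fromBlocks 0 (-1) 0 0 := by
  have hmul : ∀ p q : Idx m n, ∑ j, (beta ℂ m n).transpose p j * (-beta ℂ m n) j q =
      (-1 : Matrix (Idx m n) (Idx m n) ℂ) p q := by
    intro p q
    rw [← beta_transpose_mul, ← Matrix.mul_neg, Matrix.mul_apply]
  ext p q
  rw [ePlus, Matrix.smul_apply]
  rcases p with p | p
  · rw [sum_beta_U Sum.inl Sum.inl_injective (fun _ => rfl)]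
    rcases q with q | q
    · simp [Omega]
    · simp only [Omega, Matrix.fromBlocks_apply₁₂, hmul, smul_eq_mul]
      ring
  · rw [sum_beta_U_eq_zero _ _ _ (by simp)]
    rcases q with q | q <;> simp

/-- The bracket with an even matrix is the commutator. -/
theorem superBracket_of_even (E X : Matrix (DIdx m n) (DIdx m n) ℂ)
    (hE : ∀ p q, E p q ≠ 0 → dpar p = dpar q) : superBracket E X = E * X - X * E := by
  ext p q
  rw [superBracket, Matrix.of_apply, Matrix.sub_apply, Matrix.mul_apply, Matrix.mul_apply,
    ← Finset.sum_sub_distrib]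
  refine Finset.sum_congr rfl fun r _ => ?_
  congr 1
  by_cases h : E r q = 0
  · simp [h]
  · have h2 : Even ((dpar p + dpar r) * (dpar r + dpar q)) := by
      rw [hE r q h]
      exact Even.mul_left ⟨_, rfl⟩ _
    rw [h2.neg_one_pow, one_mul, mul_comm]

/-- For an even matrix of square zero, the exponential of its adjoint action is a conjugation. -/
theorem exp_smul_ad (c : ℂ) (E X : Matrix (DIdx m n) (DIdx m n) ℂ)
    (hE : ∀ p q, E p q ≠ 0 → dpar p = dpar q) (hsq : E * E = 0) :
    IsNilpotent.exp (c • ad E) X = (1 + c • E) * X * (1 - c • E) := by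
  have hD : ∀ Y, (c • ad E) Y = c • (E * Y - Y * E) := by
    intro Y
    rw [LinearMap.smul_apply, ← superBracket_of_even E Y hE]
    rfl
  have hD2 : ∀ Y, (c • ad E) ((c • ad E) Y) = (-2 * c ^ 2) • (E * Y * E) := by
    intro Y
    have h1 : E * (E * Y) = 0 := by rw [← mul_assoc, hsq, zero_mul]
    have h2 : Y * E * E = 0 := by rw [mul_assoc, hsq, mul_zero]
    rw [hD, hD, mul_smul_comm, smul_mul_assoc, mul_sub, sub_mul, h1, h2, ← mul_assoc]
    module
  have hD3 : (c • ad E) ^ 3 = 0 := by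
    refine LinearMap.ext fun Y => ?_
    have h1 : E * (E * Y) * E = 0 := by rw [← mul_assoc, hsq, zero_mul, zero_mul]
    have h2 : E * (Y * E) * E = 0 := by rw [mul_assoc, mul_assoc, hsq, mul_zero, mul_zero]
    rw [pow_succ', pow_two]
    change (c • ad E) ((c • ad E) ((c • ad E) Y)) = 0
    rw [hD2, hD, mul_smul_comm, smul_mul_assoc, mul_sub, sub_mul, h1, h2, sub_zero, smul_zero,
      smul_zero]
  rw [IsNilpotent.exp_eq_sum hD3, Finset.sum_range_succ, Finset.sum_range_succ,
    Finset.sum_range_one]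
  simp only [LinearMap.add_apply, LinearMap.smul_apply, ← Rat.cast_smul_eq_qsmul ℂ]
  rw [pow_zero, pow_one, pow_two]
  change _ • X + _ • (c • ad E) X + _ • (c • ad E) ((c • ad E) X) = _
  rw [hD2, hD]
  simp only [mul_sub, mul_one, one_mul, smul_mul_assoc, mul_smul_comm, add_mul]
  norm_num [Nat.factorial]
  module

/-- The matrix `[[1, -i], [-i/2, 1/2]]` of determinant one that conjugates to the Cayley
transform. -/
noncomputable def cayleyMatrix (m n : ℕ) : Matrix (DIdx m n) (DIdx m n) ℂ :=
  Matrix.fromBlocks 1 (-Complex.I • 1) (-(Complex.I / 2) • 1) ((1 / 2 : ℂ) • 1)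

theorem Omega_inv : (Omega ℂ m n)⁻¹ =
    Matrix.fromBlocks 0 (beta ℂ m n).transpose (-(beta ℂ m n).transpose) 0 := by
  refine Matrix.inv_eq_right_inv ?_
  rw [Omega, Matrix.fromBlocks_multiply]
  simp [beta_mul_transpose]

theorem cayley_mul_Omega_inv (X : Matrix (DIdx m n) (DIdx m n) ℂ) :
    cayley m n X * (Omega ℂ m n)⁻¹ =
      cayleyMatrix m n * (X * (Omega ℂ m n)⁻¹) * (cayleyMatrix m n).transpose := by
  have hI : Complex.I * Complex.I = -1 := Complex.I_mul_I
  have h1 : ∀ Y, IsNilpotent.exp (Complex.I • ad (ePlus m n)) Y =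
      (1 + Complex.I • ePlus m n) * Y * (1 - Complex.I • ePlus m n) := by
    intro Y
    refine exp_smul_ad _ _ _ ?_ ?_
    · rw [ePlus_eq]
      rintro (p | p) (q | q) h
      · simp at h
      · by_cases hpq : p = q
        · rw [hpq]; rfl
        · simp [hpq] at h
      · simp at h
      · simp at h
    · rw [ePlus_eq, Matrix.fromBlocks_multiply]
      simp
  have h2 : ∀ Y, IsNilpotent.exp ((Complex.I / 2) • ad (eMinus m n)) Y =
      (1 + (Complex.I / 2) • eMinus m n) * Y * (1 - (Complex.I / 2) • eMinus m n) := by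
    intro Y
    refine exp_smul_ad _ _ _ ?_ ?_
    · rw [eMinus_eq]
      rintro (p | p) (q | q) h
      · simp at h
      · simp at h
      · by_cases hpq : p = q
        · rw [hpq]; rfl
        · simp [hpq] at h
      · simp at h
    · rw [eMinus_eq, Matrix.fromBlocks_multiply]
      simp
  have h3 : (1 + (Complex.I / 2) • eMinus m n) * (1 + Complex.I • ePlus m n) =
      cayleyMatrix m n := by
    rw [eMinus_eq, ePlus_eq, cayleyMatrix, ← Matrix.fromBlocks_one, Matrix.fromBlocks_smul,
      Matrix.fromBlocks_smul, Matrix.fromBlocks_add, Matrix.fromBlocks_add,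
      Matrix.fromBlocks_multiply]
    congr 1
    · simp
    · simp
    · simp
    · simp only [smul_zero, add_zero, zero_add, smul_neg, Matrix.mul_neg,
        mul_smul_comm, mul_one, smul_smul, neg_neg]
      rw [← mul_div_assoc, hI]
      module
  have h4 : (1 - Complex.I • ePlus m n) * (1 - (Complex.I / 2) • eMinus m n) *
      (Omega ℂ m n)⁻¹ = (Omega ℂ m n)⁻¹ * (cayleyMatrix m n).transpose := by
    rw [Omega_inv, eMinus_eq, ePlus_eq, cayleyMatrix, ← Matrix.fromBlocks_one,
      sub_eq_add_neg, sub_eq_add_neg, Matrix.fromBlocks_smul, Matrix.fromBlocks_smul,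
      Matrix.fromBlocks_neg, Matrix.fromBlocks_neg, Matrix.fromBlocks_add, Matrix.fromBlocks_add,
      Matrix.fromBlocks_multiply, Matrix.fromBlocks_multiply, Matrix.fromBlocks_transpose,
      Matrix.fromBlocks_multiply]
    simp only [smul_zero, add_zero, zero_add, smul_neg, neg_neg,
      Matrix.neg_mul, Matrix.mul_neg, smul_mul_assoc, mul_smul_comm, mul_one, one_mul, smul_smul,
      mul_zero, zero_mul, Matrix.transpose_smul, Matrix.transpose_one, div_eq_mul_inv,
      neg_smul, Matrix.transpose_neg, add_mul]
    congr 1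
    all_goals first | module | (match_scalars; linear_combination (1 / 2 : ℂ) * hI)
  rw [cayley, Module.End.mul_apply, h1, h2]
  rw [← h3]
  simp only [mul_assoc] at h4 ⊢
  rw [h4]
  simp only [← mul_assoc]
  rw [h3]

end Cayley

/-! ### Intertwining -/

section Final

variable {m n : ℕ}

theorem sum_cayleyMatrix_inl (i : Idx m n) (h : DIdx m n → Smooth ℂ m n) :
    ∑ a, cayleyMatrix m n a (Sum.inl i) • h a =
      h (Sum.inl i) - (Complex.I / 2) • h (Sum.inr i) := by
  rw [Fintype.sum_sum_type]
  simp only [cayleyMatrix, Matrix.fromBlocks_apply₁₁, Matrix.fromBlocks_apply₂₁, Matrix.smul_apply,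
    Matrix.one_apply, smul_eq_mul, mul_ite, mul_one, mul_zero, ite_smul, one_smul, zero_smul,
    Finset.sum_ite_eq', Finset.mem_univ, if_true]
  module

theorem sum_cayleyMatrix_inr (i : Idx m n) (h : DIdx m n → Smooth ℂ m n) :
    ∑ a, cayleyMatrix m n a (Sum.inr i) • h a =
      (1 / 2 : ℂ) • h (Sum.inr i) - Complex.I • h (Sum.inl i) := by
  rw [Fintype.sum_sum_type]
  simp only [cayleyMatrix, Matrix.fromBlocks_apply₁₂, Matrix.fromBlocks_apply₂₂, Matrix.smul_apply,
    Matrix.one_apply, smul_eq_mul, mul_ite, mul_one, mul_zero, ite_smul, zero_smul,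
    Finset.sum_ite_eq', Finset.mem_univ, if_true]
  module

/-- The substitution `ℓ_i ↦ ½ (ℓ_i + ∂_i)`, `∂_i ↦ ∂_i - ℓ_i` acts on the quadratic operators
through the matrix of the Cayley transform. -/
theorem IsTransform.genOp {f : Smooth ℝ m n} {F : Smooth ℂ m n} (h : IsTransform f F)
    (a b : DIdx m n) :
    IsTransform (genOp a b f) (∑ a', cayleyMatrix m n a' a • ∑ b', cayleyMatrix m n b' b •
      genOp a' b' F) := by
  have hs : ∀ i j : Idx m n, (-1 : ℂ) ^ (par i * par j) = 1 ∨ (-1 : ℂ) ^ (par i * par j) = -1 :=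
    fun i j => neg_one_pow_eq_or ℂ _
  have hll : ∀ i j : Idx m n, SuperSB.genOp (Sum.inl i) (Sum.inl j) F =
      (-(Complex.I / 2)) • SuperSB.partialLow i (SuperSB.partialLow j F) := fun _ _ => rfl
  have hlr : ∀ i j : Idx m n, SuperSB.genOp (Sum.inl i) (Sum.inr j) F =
      (-(1 / 2) * beta ℂ m n i j) • F -
        (-1 : ℂ) ^ (par i * par j) • SuperSB.mulOp j (SuperSB.partialLow i F) := fun _ _ => rfl
  have hrl : ∀ i j : Idx m n, SuperSB.genOp (Sum.inr i) (Sum.inl j) F =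
      (-1 : ℂ) ^ (par i * par j) • ((-(1 / 2) * beta ℂ m n j i) • F -
        (-1 : ℂ) ^ (par i * par j) • SuperSB.mulOp i (SuperSB.partialLow j F)) := fun _ _ => rfl
  have hrr : ∀ i j : Idx m n, SuperSB.genOp (Sum.inr i) (Sum.inr j) F =
      (2 * Complex.I) • SuperSB.mulOp i (SuperSB.mulOp j F) := fun _ _ => rfl
  -- in each of the four blocks both sides are combinations of `F`, `ℓ_i ℓ_j F`, `ℓ ∂ F` and
  -- `∂_i ∂_j F`, whose coefficients agree for both values of the sign `(-1)^{|i||j|}`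
  rcases a with i | i <;> rcases b with j | j
  · have h1 := ((h.partialLow j).partialLow i).smul (-(Complex.I / 2))
    convert! h1 using 1
    simp only [sum_cayleyMatrix_inl, hll, hlr, hrl, hrr, map_sub, partialLow_mulOp,
      beta_swap i j]
    rcases hs i j with hs | hs <;> rw [hs] <;> match_scalars <;>
      first | ring1 | (ring_nf; simp only [Complex.I_pow_three]; ring1)
  · have hm : SuperSB.mulOp j (SuperSB.mulOp i F) =
        (-1 : ℂ) ^ (par i * par j) • SuperSB.mulOp i (SuperSB.mulOp j F) := by
      rw [mulOp_comm, mul_comm (par j)]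
    have hp : SuperSB.partialLow j (SuperSB.partialLow i F) =
        (-1 : ℂ) ^ (par i * par j) • SuperSB.partialLow i (SuperSB.partialLow j F) := by
      rw [partialLow_comm, mul_comm (par j)]
    have h1 := (h.smul (-(1 / 2) * beta ℂ m n i j)).sub
      (((h.partialLow i).mulOp j).smul ((-1) ^ (par i * par j)))
    convert! h1 using 1
    simp only [sum_cayleyMatrix_inl, sum_cayleyMatrix_inr, hll, hlr, hrl, hrr, map_sub,
      partialLow_mulOp, beta_swap i j, mul_comm (par j), hm, hp]
    rcases hs i j with hs | hs <;> rw [hs] <;> match_scalars <;>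
      first | ring1 | (ring_nf; simp only [Complex.I_sq]; ring1)
  · have h1 := ((h.smul (-(1 / 2) * beta ℂ m n j i)).sub
      (((h.partialLow j).mulOp i).smul ((-1) ^ (par i * par j)))).smul ((-1) ^ (par i * par j))
    convert! h1 using 1
    simp only [sum_cayleyMatrix_inl, sum_cayleyMatrix_inr, hll, hlr, hrl, hrr, map_sub,
      partialLow_mulOp, beta_swap i j]
    rcases hs i j with hs | hs <;> rw [hs] <;> match_scalars <;>
      first | ring1 | (ring_nf; simp only [Complex.I_sq]; ring1)
  · have h1 := ((h.mulOp j).mulOp i).smul (2 * Complex.I)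
    convert! h1 using 1
    simp only [sum_cayleyMatrix_inr, hll, hlr, hrl, hrr, map_add, map_smul, partialLow_mulOp,
      beta_swap i j]
    rcases hs i j with hs | hs <;> rw [hs] <;> match_scalars <;>
      first | ring1 | (ring_nf; simp only [Complex.I_pow_three]; ring1)

/-- The intertwining relation: both the substitution and the Cayley transform turn the coefficient
matrix `X Ω⁻¹` of the quadratic operator into `g (X Ω⁻¹) gᵀ`. -/
theorem IsTransform.metaplectic {f : Smooth ℝ m n} {F : Smooth ℂ m n} (h : IsTransform f F)
    (X : Matrix (DIdx m n) (DIdx m n) ℂ) :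
    IsTransform (metaplectic X f) (metaplectic (cayley m n X) F) := by
  have h1 := (IsTransform.sum Finset.univ fun a _ => IsTransform.sum Finset.univ fun b _ =>
    (h.genOp a b).smul ((X * (Omega ℂ m n)⁻¹) a b)).smul (1 / 2)
  rw [metaplectic_apply, metaplectic_apply, cayley_mul_Omega_inv]
  convert! h1 using 2
  simp only [Matrix.mul_apply (M := cayleyMatrix m n * _), Matrix.mul_apply (M := cayleyMatrix m n),
    Matrix.transpose_apply, Finset.sum_mul, Finset.sum_smul, Finset.smul_sum, smul_smul]
  symm
  refine ((Finset.sum_congr rfl fun a _ => Finset.sum_comm).trans Finset.sum_comm).trans ?_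
  refine Finset.sum_congr rfl fun a' _ => ?_
  refine ((Finset.sum_congr rfl fun a _ => Finset.sum_comm).trans Finset.sum_comm).trans ?_
  refine Finset.sum_congr rfl fun b' _ => ?_
  rw [Finset.sum_comm]
  refine Finset.sum_congr rfl fun b _ => Finset.sum_congr rfl fun a _ => ?_
  congr 1
  ring

/-- The transform maps the Schrödinger module into the Fock module. -/
theorem IsTransform.mem_fockModule (K : Type*) [Field K] [Algebra K ℂ] {f : Smooth ℝ m n}
    {F : Smooth ℂ m n} (h : IsTransform f F) (hf : f ∈ schrodingerModule K m n) :
    F ∈ fockModule K m n := by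
  let W : Submodule ℂ (Smooth ℝ m n) :=
    { carrier := {f | ∃ F ∈ fockModule K m n, IsTransform f F}
      add_mem' := fun ⟨F, hF, hfF⟩ ⟨G, hG, hgG⟩ => ⟨F + G, add_mem hF hG, hfF.add hgG⟩
      zero_mem' := ⟨0, zero_mem _, by
        simpa using IsTransform.sum (m := m) (n := n) (∅ : Finset ℕ) (f := 0) (F := 0) (by simp)⟩
      smul_mem' := fun c _ ⟨F, hF, hfF⟩ => ⟨c • F, Submodule.smul_mem _ c hF, hfF.smul c⟩ }
  have hinv : ∀ X, ∀ f ∈ W, schrodinger K m n X f ∈ W := fun X _ ⟨F, hF, hfF⟩ =>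
    ⟨fock K m n X F, generated_sup_invariant _ _ _ X hF, hfF.metaplectic _⟩
  have hgen : ∀ s : Set (Smooth ℂ m n), s ⊆ generated (fock K m n) s := fun s x hx =>
    Submodule.mem_sInf.2 fun _ hV => hV.1 hx
  have hW : schrodingerModule K m n ≤ W := by
    refine sup_le (sInf_le ⟨?_, hinv⟩) (sInf_le ⟨?_, hinv⟩)
    · rintro _ rfl
      exact ⟨oneFun m n, Submodule.mem_sup_left (hgen _ rfl), isTransform_expNegRsq⟩
    · rintro _ ⟨i, hi, rfl⟩
      exact ⟨_, Submodule.smul_mem _ _ (Submodule.mem_sup_right (hgen _ ⟨i, hi, rfl⟩)),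
        isTransform_mulOp_expNegRsq i⟩
  obtain ⟨G, hG, hfG⟩ := hW hf
  rwa [h.unique hfG]

end Final

end SuperSB

theorem theorem7p2 (K : Type*) [Field K] [Algebra K ℂ] (m n : ℕ) :
    SuperSB.omega m n ≠ 0 ∧
    (∀ f ∈ SuperSB.schrodingerModule K m n, ∀ z : Fin m → ℂ,
      Integrable (SuperSB.sbIntegrand f.1 z)) ∧
    ∃ SB : SuperSB.schrodingerModule K m n →ₗ[ℂ] SuperSB.fockModule K m n,
      (∀ (f : SuperSB.schrodingerModule K m n) (z : Fin m → ℂ),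
        (SB f).1.1 z = SuperSB.segalBargmann f.1.1 z) ∧
      ∀ X : SuperSB.spo K m n,
        SB ∘ₗ SuperSB.schrodingerAction K m n X = SuperSB.fockAction K m n X ∘ₗ SB := by
  refine ⟨SuperSB.omega_ne_zero m n,
    fun f hf => SuperSB.integrable_sbIntegrand (SuperSB.schrodingerModule_le K hf), ?_⟩
  choose T hT using fun f : SuperSB.schrodingerModule K m n =>
    SuperSB.exists_isTransform (SuperSB.schrodingerModule_le K f.2)
  refine ⟨{ toFun := fun f => ⟨T f, (hT f).mem_fockModule K f.2⟩
            map_add' := fun f g => Subtype.ext ((hT (f + g)).unique ((hT f).add (hT g)))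
            map_smul' := fun c f => Subtype.ext ((hT (c • f)).unique ((hT f).smul c)) },
    fun f => (hT f).2, fun X => LinearMap.ext fun f => Subtype.ext ?_⟩
  exact (hT _).unique ((hT f).metaplectic _)
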